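/- All modules are left modules. An Artin algebra is an algebra that is finitely generated as a module over a commutative artinian ring. For an Artin algebra $A$ let $A\text{-mod}$ be the category of finitely generated $A$-modules. A module $G\in A\text{-mod}$ is Gorenstein projective if $G\cong \operatorname{Ker} d^0$ for some exact complex $P^\bullet$ of projective $A$-modules (with differentials $d^i:P^i\to P^{i+1}$) such that $\operatorname{Hom}_A(P^\bullet,Q)$ is exact for every projective $A$-module $Q$; let $A\text{-Gproj}\subseteq A\text{-mod}$ be the full subcategory of these modules. The algebra $A$ is CM-finite if, up to isomorphism, there are only finitely many indecomposable modules $G_1,\dots,G_m$ in $A\text{-Gproj}$; then $G_A=\bigoplus_{i=1}^m G_i$ denotes its Gorenstein projective generator. The bounded Gorenstein derived category $D^b_{gp}(A\text{-mod})$ is the Verdier quotient of $K^b(A\text{-mod})$ by the full subcategory of the complexes $X^\bullet$ such that $\operatorname{Hom}_A(G,X^\bullet)$ is acyclic for all $G\in A\text{-Gproj}$. **Lemma 2.1.** Let $A$ and $B$ be CM-finite Artin algebras with Gorenstein projective generators $G_A$ and $G_B$, and let $F:D^b_{gp}(A\text{-mod})\to D^b_{gp}(B\text{-mod})$ be a triangle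 equivalence with quasi-inverse $F^{-1}$. Then for every integer $n\ge 0$ the following are equivalent: 1. $F(G_A)$ is isomorphic in $D^b_{gp}(B\text{-mod})$ to a complex $\bar T^\bullet\in K^b(B\text{-Gproj})$ of the form $0\to \bar T^0\to \bar T^1\to\cdots\to \bar T^n\to 0$; 2. $F^{-1}(G_B)$ is isomorphic in $D^b_{gp}(A\text{-mod})$ to a complex $T^\bullet\in K^b(A\text{-Gproj})$ of the form $0\to T^{-n}\to\cdots\to T^{-1}\to T^0\to 0$. -/

import Mathlib

open CategoryTheory CategoryTheory.Limits

universe u v w w'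

namespace GorensteinDerived

/-! ### Finitely generated modules and Gorenstein projective modules

For a ring `A`, `FGModuleCat A` is the category `A-mod` of finitely generated left `A`-modules. -/

section GorensteinProjective

variable (A : Type u) [Ring A]

instance : HasFiniteBiproducts (FGModuleCat.{u} A) :=
  HasFiniteBiproducts.of_hasFiniteCoproducts

instance : HasBinaryBiproducts (FGModuleCat.{u} A) :=
  hasBinaryBiproducts_of_finite_biproducts _

instance : HasZeroObject (FGModuleCat.{u} A) :=
  hasZeroObject_of_hasInitial_object

/-- A complete projective resolution: an exact complex
`⋯ ⟶ P⁻¹ ⟶ P⁰ ⟶ P¹ ⟶ ⋯` of projective `A`-modules such that for every projective `A`-module `Q`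
the complex `Hom_A(P, Q)` is exact, i.e. `Hom(Pⁱ⁺¹, Q) ⟶ Hom(Pⁱ, Q) ⟶ Hom(Pⁱ⁻¹, Q)` is exact at the
middle term for every `i`. -/
structure IsTotallyAcyclic (P : CochainComplex (ModuleCat.{u} A) ℤ) : Prop where
  projective : ∀ i : ℤ, Module.Projective A (P.X i)
  acyclic : P.Acyclic
  hom_exact : ∀ Q : ModuleCat.{u} A, Module.Projective A Q →
    ∀ (i : ℤ) (f : P.X i ⟶ Q), P.d (i - 1) i ≫ f = 0 →
      ∃ g : P.X (i + 1) ⟶ Q, P.d i (i + 1) ≫ g = f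

/-- A finitely generated `A`-module `G` is Gorenstein projective if `G ≅ Ker d⁰` for some complete
projective resolution. The objects with this property form `A-Gproj`. -/
def gproj : ObjectProperty (FGModuleCat.{u} A) := fun G =>
  ∃ P : CochainComplex (ModuleCat.{u} A) ℤ,
    IsTotallyAcyclic A P ∧ Nonempty (G.obj ≅ kernel (P.d 0 1))

/-- `G 0, …, G (m - 1)` is a complete, irredundant list, up to isomorphism, of the
indecomposable finitely generated Gorenstein projective `A`-modules. -/
structure IsIndecGprojList {m : ℕ} (G : Fin m → FGModuleCat.{u} A) : Prop where
  indecomposable : ∀ i, Indecomposable (G i)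
  gproj : ∀ i, gproj A (G i)
  irredundant : ∀ i j, Nonempty (G i ≅ G j) → i = j
  complete : ∀ X : FGModuleCat.{u} A, Indecomposable X → GorensteinDerived.gproj A X →
    ∃ i, Nonempty (X ≅ G i)

/-- `A` is CM-finite if it has only finitely many indecomposable finitely generated
Gorenstein projective modules up to isomorphism. -/
def IsCMFinite : Prop :=
  ∃ (m : ℕ) (G : Fin m → FGModuleCat.{u} A), IsIndecGprojList A G

/-- `GA` is the Gorenstein projective generator `G₁ ⊕ ⋯ ⊕ Gₘ` of `A`. -/
def IsGprojGenerator (GA : FGModuleCat.{u} A) : Prop :=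
  ∃ (m : ℕ) (G : Fin m → FGModuleCat.{u} A), IsIndecGprojList A G ∧ Nonempty (GA ≅ ⨁ G)

end GorensteinProjective

/-! ### The bounded homotopy category -/

section Bounded

variable (C : Type u) [Category.{v} C] [Preadditive C]

/-- A cochain complex is bounded if its terms vanish outside some interval `[a, b]`. -/
def IsBounded (K : CochainComplex C ℤ) : Prop :=
  ∃ a b : ℤ, K.IsStrictlyGE a ∧ K.IsStrictlyLE b

/-- The objects of the homotopy category whose underlying complex is bounded. -/
def bounded : ObjectProperty (HomotopyCategory C (ComplexShape.up ℤ)) :=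
  fun X => IsBounded C X.as

/-- The bounded homotopy category `Kᵇ(C)`. -/
abbrev Kb := (bounded C).FullSubcategory

variable {C} in
lemma bounded_quotient_obj_iff (K : CochainComplex C ℤ) :
    bounded C ((HomotopyCategory.quotient _ _).obj K) ↔ IsBounded C K := Iff.rfl

variable [HasZeroObject C]

open ZeroObject in
instance : (bounded C).ContainsZero where
  exists_zero :=
    ⟨(HomotopyCategory.quotient _ _).obj 0, Functor.map_isZero _ (isZero_zero _),
      0, 0, inferInstanceAs ((0 : CochainComplex C ℤ).IsStrictlyGE 0),
      inferInstanceAs ((0 : CochainComplex C ℤ).IsStrictlyLE 0)⟩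

instance : (bounded C).IsStableUnderShift ℤ where
  isStableUnderShiftBy n :=
    { le_shift K hK := by
        obtain ⟨K : CochainComplex _ _, rfl⟩ := K.quotient_obj_surjective
        obtain ⟨a, b, ha, hb⟩ := hK
        have ha : K.IsStrictlyGE a := ha
        have hb : K.IsStrictlyLE b := hb
        rw [ObjectProperty.prop_shift_iff, HomotopyCategory.shift_quotient_obj,
          bounded_quotient_obj_iff]
        exact ⟨a - n, b - n, K.isStrictlyGE_shift a n (a - n) (by lia),
          K.isStrictlyLE_shift b n (b - n) (by lia)⟩ }

variable [HasBinaryBiproducts C]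

open Pretriangulated in
instance : (bounded C).IsTriangulatedClosed₃ where
  ext₃' T hT h₁ h₂ := by
    obtain ⟨a₁, b₁, _, _⟩ := h₁
    obtain ⟨a₂, b₂, _, _⟩ := h₂
    obtain ⟨f : T.obj₁.as ⟶ T.obj₂.as, hf⟩ :=
      (HomotopyCategory.quotient _ _).map_surjective T.mor₁
    refine ⟨(HomotopyCategory.quotient _ _).obj (CochainComplex.mappingCone f), ?_,
      ⟨Triangle.π₃.mapIso (isoTriangleOfIso₁₂ T _ hT
        (HomotopyCategory.mappingCone_triangleh_distinguished f)
        (Iso.refl _) (Iso.refl _) ?_)⟩⟩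
    · refine ⟨min (a₁ - 1) a₂, max b₁ b₂,
        CochainComplex.isStrictlyGE_mappingCone f a₁ a₂ _ (by simp) (by simp), ?_⟩
      change (CochainComplex.mappingCone f).IsStrictlyLE _
      rw [CochainComplex.isStrictlyLE_iff]
      intro i hi
      simp only [CochainComplex.mappingCone.isZero_X_iff]
      exact ⟨CochainComplex.isZero_of_isStrictlyLE T.obj₁.as b₁ _ (by lia),
        CochainComplex.isZero_of_isStrictlyLE T.obj₂.as b₂ _ (by lia)⟩
    · exact (Category.comp_id _).trans (hf.symm.trans (Category.id_comp _).symm)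

instance : (bounded C).IsTriangulated where
  toIsTriangulatedClosed₂ := .of_isTriangulatedClosed₃

end Bounded

/-! ### The bounded Gorenstein derived category -/

section GorensteinDerivedCategory

variable (A : Type u) [Ring A]

/-- The functor `K(A-mod) ⥤ K(Ab)`, `X ↦ Hom_A(G, X)`. -/
noncomputable abbrev homFunctor (G : FGModuleCat.{u} A) :
    HomotopyCategory (FGModuleCat.{u} A) (ComplexShape.up ℤ) ⥤
      HomotopyCategory AddCommGrpCat.{u} (ComplexShape.up ℤ) :=
  (preadditiveCoyoneda.obj (Opposite.op G)).mapHomotopyCategory (ComplexShape.up ℤ)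

/-- `X` is `G`-acyclic if `Hom_A(G, X)` is acyclic for every `G ∈ A-Gproj`. -/
def gAcyclic : ObjectProperty (HomotopyCategory (FGModuleCat.{u} A) (ComplexShape.up ℤ)) :=
  fun X => ∀ G : FGModuleCat.{u} A, gproj A G →
    HomotopyCategory.subcategoryAcyclic AddCommGrpCat.{u} ((homFunctor A G).obj X)

/-- The condition `gAcyclic` on the level of complexes. -/
lemma gAcyclic_quotient_obj_iff (X : CochainComplex (FGModuleCat.{u} A) ℤ) :
    gAcyclic A ((HomotopyCategory.quotient _ _).obj X) ↔
      ∀ G : FGModuleCat.{u} A, gproj A G →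
        (((preadditiveCoyoneda.obj (Opposite.op G)).mapHomologicalComplex
          (ComplexShape.up ℤ)).obj X).Acyclic :=
  forall₂_congr fun _ _ =>
    HomotopyCategory.quotient_obj_mem_subcategoryAcyclic_iff_acyclic _

instance : (gAcyclic A).IsClosedUnderIsomorphisms where
  of_iso e h G hG := ObjectProperty.prop_of_iso _ ((homFunctor A G).mapIso e) (h G hG)

open ZeroObject in
instance : (gAcyclic A).IsTriangulated where
  exists_zero := ⟨0, isZero_zero _, fun G _ =>
    ((HomotopyCategory.subcategoryAcyclic AddCommGrpCat.{u}).inverseImage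
      (homFunctor A G)).prop_zero⟩
  isStableUnderShiftBy n :=
    { le_shift := fun X h G hG =>
        ((HomotopyCategory.subcategoryAcyclic AddCommGrpCat.{u}).inverseImage
          (homFunctor A G)).le_shift n X (h G hG) }
  toIsTriangulatedClosed₂ := .mk' (fun T hT h₁ h₃ G hG =>
    ((HomotopyCategory.subcategoryAcyclic AddCommGrpCat.{u}).inverseImage
      (homFunctor A G)).ext_of_isTriangulatedClosed₂ T hT (h₁ G hG) (h₃ G hG))

/-- The thick subcategory `Kᵇ_gpac(A-mod)` of `Kᵇ(A-mod)` of bounded `G`-acyclic complexes. -/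
def gAcyclicKb : ObjectProperty (Kb (FGModuleCat.{u} A)) :=
  (gAcyclic A).inverseImage (bounded (FGModuleCat.{u} A)).ι

instance : (gAcyclicKb A).IsTriangulated :=
  inferInstanceAs ((gAcyclic A).inverseImage (bounded (FGModuleCat.{u} A)).ι).IsTriangulated

/-- The bounded Gorenstein derived category, i.e. the Verdier quotient
`Dᵇ_gp(A-mod) = Kᵇ(A-mod) / Kᵇ_gpac(A-mod)`: the localization of `Kᵇ(A-mod)` at the morphisms whose
cone is `G`-acyclic, with the triangulated structure of a localization. -/
abbrev DbGp := (gAcyclicKb A).trW.Localization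

/-- A bounded complex of finitely generated modules, as an object of `Dᵇ_gp(A-mod)`. -/
noncomputable def toDbGp (X : CochainComplex (FGModuleCat.{u} A) ℤ)
    (hX : IsBounded (FGModuleCat.{u} A) X) : DbGp A :=
  (gAcyclicKb A).trW.Q.obj ⟨(HomotopyCategory.quotient _ _).obj X, hX⟩

/-- A finitely generated module as a stalk complex in degree `0` in `Dᵇ_gp(A-mod)`. -/
noncomputable def stalk (M : FGModuleCat.{u} A) : DbGp A :=
  toDbGp A ((CochainComplex.singleFunctor (FGModuleCat.{u} A) 0).obj M)
    ⟨0, 0, inferInstance, inferInstance⟩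

/-- `X ∈ Dᵇ_gp(A-mod)` is isomorphic, in `Dᵇ_gp(A-mod)`, to a complex in `Kᵇ(A-Gproj)` of the form
`0 ⟶ Tᵃ ⟶ ⋯ ⟶ Tᵇ ⟶ 0`. -/
def IsoToGprojComplexIn (a b : ℤ) (X : DbGp A) : Prop :=
  ∃ (T : CochainComplex (FGModuleCat.{u} A) ℤ) (ha : T.IsStrictlyGE a) (hb : T.IsStrictlyLE b),
    (∀ i : ℤ, gproj A (T.X i)) ∧ Nonempty (X ≅ toDbGp A T ⟨a, b, ha, hb⟩)

end GorensteinDerivedCategory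

end GorensteinDerived

/-! Write G for the stalk complex of `GA`. Homotopy classes of maps from a bounded complex of
Gorenstein projectives to a bounded G-acyclic complex vanish, so maps out of such a complex in the
Gorenstein derived category are represented by chain maps. In particular Hom(G, X⟦i⟧) is the i-th
cohomology of Hom_A(GA, X) (`extVanish_stalk_iff`). Vanishing of these groups for i > 0, resp. i <
0, therefore defines a bounded t-structure (D^{≤0}, D^{≥0}): its triangles come from truncating
complexes, and each Hom(G, X) has finite length over End(G) (`isHeartGenerator_stalk`).

This t-structure detects complexes of Gorenstein projectives in degrees [a, b] intrinsically: X is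
isomorphic to one iff X ∈ D^{≤b} and Hom(X, D^{≤a-1}) = 0. Necessity is `extLE_toDbGp` and
`hom_eq_zero_of_isoToGprojComplexIn`. For sufficiency (`isoToGprojComplexIn_of_extLE`) one resolves
X by powers of G until orthogonality makes the last syzygy a summand of such a power.

Let F(G_A) lie in degrees [a, b]. Then Hom(G_A, F⁻¹G_B⟦i⟧) = Hom(F G_A, G_B⟦i⟧) vanishes for i > -a.
It remains to see that Hom(F⁻¹G_B, W) = Hom(G_B, F W) vanishes for W ∈ D^{≤-b-1}, which needs
F(D^{≤0}) ⊆ D^{≤b}, while a priori only F(G_A) ∈ D^{≤b}. Objects of the aisle need not have finite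
resolutions by powers of G. Instead, objects of the heart are filtered by finitely many cyclic ones,
so some uniform bound N holds on the whole aisle (`exists_extLE_map`); a triangle G^r → V → W with W
∈ D^{≤-1} then lowers any bound above b by one (`extLE_map`). Hence F⁻¹G_B lies in degrees [-b, -a],
and applying this to F and to F⁻¹ gives both implications.

Mapping cones, splitting of idempotents and testing acyclicity on `GA` alone require Gorenstein
projectives to be closed under sums and summands; this is proved through `IsGorensteinClass`. -/

namespace GorensteinDerived

open Pretriangulated MulOpposite

/-! ### Annihilators in modules of finite length -/

section FiniteLength

/-- A module of finite length has finitely many ideals among which every nonzero linear map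
from it finds the annihilator of a nonzero vector. -/
lemma exists_finite_annihilators {R : Type u} [Ring R] {M : Type v} [AddCommGroup M] [Module R M]
    (hM : IsFiniteLength R M) :
    ∃ s : Set (Submodule R R), s.Finite ∧
      ∀ (N : Type w) [AddCommGroup N] [Module R N] (f : M →ₗ[R] N), f ≠ 0 →
        ∃ y : N, y ≠ 0 ∧ LinearMap.ker (LinearMap.toSpanSingleton R N y) ∈ s := by
  induction hM with
  | of_subsingleton =>
    refine ⟨∅, Set.finite_empty, fun N _ _ f hf => (hf ?_).elim⟩
    ext x
    rw [Subsingleton.elim x 0]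
    simp
  | @of_simple_quotient M _ _ P hP h ih =>
    obtain ⟨s, hs, ih⟩ := ih
    have := IsSimpleModule.nontrivial R (M ⧸ P)
    obtain ⟨q, hq⟩ := exists_ne (0 : M ⧸ P)
    obtain ⟨m, rfl⟩ := P.mkQ_surjective q
    -- One new ideal per composition factor: the annihilator of a fixed generator of the simple
    -- quotient. A map vanishing on `P` embeds that quotient, so the image of `m` has exactly this
    -- annihilator; any other map is handled by restriction to `P`.
    refine ⟨insert (LinearMap.ker (LinearMap.toSpanSingleton R _ (P.mkQ m))) s, hs.insert _,
      fun N _ _ f hf => ?_⟩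
    by_cases hfP : f ∘ₗ P.subtype = 0
    · have hle : P ≤ LinearMap.ker f := fun x hx => LinearMap.congr_fun hfP ⟨x, hx⟩
      have hinj : Function.Injective (P.liftQ f hle) := by
        refine ((P.liftQ f hle).injective_or_eq_zero).resolve_right fun h0 => hf ?_
        rw [← P.liftQ_mkQ f hle, h0, LinearMap.zero_comp]
      refine ⟨f m, ?_, Or.inl ?_⟩
      · intro h0
        exact hq (hinj (by simpa using h0))
      · ext r
        simp only [LinearMap.mem_ker, LinearMap.toSpanSingleton_apply]
        rw [← map_smul, ← map_smul, ← P.liftQ_mkQ f hle, LinearMap.comp_apply,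
          map_eq_zero_iff _ hinj]
    · obtain ⟨y, hy, hys⟩ := ih N _ hfP
      exact ⟨y, hy, Or.inr hys⟩

end FiniteLength

lemma comp_comp_eq_zero {C : Type u} [Category.{v} C] [HasZeroMorphisms C] {W X Y Z : C}
    (f : W ⟶ X) {g : X ⟶ Y} {h : Y ⟶ Z} (hgh : g ≫ h = 0) : (f ≫ g) ≫ h = 0 := by
  rw [Category.assoc, hgh, comp_zero]

/-! ### t-structures cut out by a generator of the heart -/

section Triangulated

set_option linter.unusedSectionVars false

variable {T : Type u} [Category.{v} T] [Preadditive T] [HasZeroObject T] [HasShift T ℤ]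
  [∀ n : ℤ, (shiftFunctor T n).Additive] [Pretriangulated T]

/-- `Hom(G, X⟦i⟧) = 0`. -/
def ExtVanish (G X : T) (i : ℤ) : Prop := ∀ f : G ⟶ X⟦i⟧, f = 0

/-- `Hom(G, X⟦i⟧) = 0` for all `i > n`. -/
def ExtLE (G : T) (n : ℤ) (X : T) : Prop := ∀ i : ℤ, n < i → ExtVanish G X i

/-- `Hom(G, X⟦i⟧) = 0` for all `i < n`. -/
def ExtGE (G : T) (n : ℤ) (X : T) : Prop := ∀ i : ℤ, i < n → ExtVanish G X i

lemma ExtLE.mono {G X : T} {n m : ℤ} (h : ExtLE G n X) (hnm : n ≤ m) : ExtLE G m X :=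
  fun i hi => h i (by lia)

lemma ExtVanish.of_iso {G X Y : T} {i : ℤ} (h : ExtVanish G X i) (e : X ≅ Y) :
    ExtVanish G Y i := fun f => by
  rw [← cancel_mono (e.inv⟦i⟧'), zero_comp]
  exact h _

lemma ExtLE.of_iso {G X Y : T} {n : ℤ} (h : ExtLE G n X) (e : X ≅ Y) : ExtLE G n Y :=
  fun i hi => (h i hi).of_iso e

lemma extVanish_shift_iff {G X : T} {a i j : ℤ} (h : a + i = j) :
    ExtVanish G (X⟦a⟧) i ↔ ExtVanish G X j := by
  let e := (shiftFunctorAdd' T a i j h).app X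
  refine ⟨fun H f => ?_, fun H f => ?_⟩
  · rw [← cancel_mono e.hom, zero_comp]
    exact H _
  · rw [← cancel_mono e.inv, zero_comp]
    exact H _

lemma extLE_shift_iff {G X : T} {a n m : ℤ} (h : a + n = m) :
    ExtLE G n (X⟦a⟧) ↔ ExtLE G m X :=
  ⟨fun H i hi => (extVanish_shift_iff (i := i - a) (by lia)).1 (H _ (by lia)),
    fun H i hi => (extVanish_shift_iff rfl).2 (H _ (by lia))⟩

lemma extGE_shift_iff {G X : T} {a n m : ℤ} (h : a + n = m) :
    ExtGE G n (X⟦a⟧) ↔ ExtGE G m X :=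
  ⟨fun H i hi => (extVanish_shift_iff (i := i - a) (by lia)).1 (H _ (by lia)),
    fun H i hi => (extVanish_shift_iff rfl).2 (H _ (by lia))⟩

lemma extVanish_zero_iff {G X : T} : ExtVanish G X 0 ↔ ∀ f : G ⟶ X, f = 0 := by
  let e := (shiftFunctorZero T ℤ).app X
  refine ⟨fun H f => ?_, fun H f => ?_⟩
  · rw [← cancel_mono e.inv, zero_comp]
    exact H _
  · rw [← cancel_mono e.hom, zero_comp]
    exact H _

lemma ExtVanish.ext₂ {G : T} {S : Triangle T} (hS : S ∈ distTriang T) {i : ℤ}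
    (h₁ : ExtVanish G S.obj₁ i) (h₃ : ExtVanish G S.obj₃ i) : ExtVanish G S.obj₂ i := fun f => by
  obtain ⟨g, rfl⟩ := Triangle.coyoneda_exact₂ _ (Triangle.shift_distinguished S hS i) f (h₃ _)
  rw [h₁ g]
  exact zero_comp

lemma ExtVanish.ext₃ {G : T} {S : Triangle T} (hS : S ∈ distTriang T) {i j : ℤ} (hij : i + 1 = j)
    (h₂ : ExtVanish G S.obj₂ i) (h₁ : ExtVanish G S.obj₁ j) : ExtVanish G S.obj₃ i :=
  ExtVanish.ext₂ (rot_of_distTriang _ hS) h₂ ((extVanish_shift_iff (by lia)).2 h₁)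

lemma ExtVanish.ext₁ {G : T} {S : Triangle T} (hS : S ∈ distTriang T) {i j : ℤ} (hij : i + 1 = j)
    (h₃ : ExtVanish G S.obj₃ i) (h₂ : ExtVanish G S.obj₂ j) : ExtVanish G S.obj₁ j :=
  ExtVanish.ext₂ (inv_rot_of_distTriang _ hS) ((extVanish_shift_iff (by lia)).2 h₃) h₂

/-- The direct sum of `r` copies of `G`. -/
noncomputable abbrev power (G : T) (r : ℕ) : T := ⨁ fun _ : Fin r => G

lemma ExtVanish.power {G X : T} {i : ℤ} (h : ExtVanish G X i) (r : ℕ) :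
    ExtVanish G (power X r) i := fun f => by
  have : f = f ≫ (𝟙 (GorensteinDerived.power X r))⟦i⟧' := by simp
  rw [this, ← biproduct.total, Functor.map_sum, Preadditive.comp_sum]
  refine Finset.sum_eq_zero fun j _ => ?_
  rw [Functor.map_comp, ← Category.assoc, h (f ≫ _), zero_comp]

lemma ExtLE.power {G X : T} {n : ℤ} (h : ExtLE G n X) (r : ℕ) : ExtLE G n (power X r) :=
  fun i hi => (h i hi).power r

/-- A generator of the heart of a bounded t-structure with finite length heart, whose aisle and
coaisle are given by the vanishing of `Hom(G, X⟦i⟧)`. -/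
structure IsHeartGenerator (G : T) : Prop where
  self : ∀ i : ℤ, i ≠ 0 → ExtVanish G G i
  exists_trunc : ∀ X : T, ∃ (U V : T) (f : U ⟶ X) (g : X ⟶ V) (h : V ⟶ U⟦(1 : ℤ)⟧),
    Triangle.mk f g h ∈ (distTriang T) ∧ ExtLE G (-1) U ∧ ExtGE G 0 V
  orth : ∀ {X Y : T}, ExtLE G (-1) X → ExtGE G 0 Y → ∀ f : X ⟶ Y, f = 0
  bounded : ∀ X : T, ∃ a b : ℤ, ExtGE G a X ∧ ExtLE G b X
  isNoetherian : ∀ X : T, IsNoetherian (End G)ᵐᵒᵖ (G ⟶ X)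
  isArtinian : ∀ X : T, IsArtinian (End G)ᵐᵒᵖ (G ⟶ X)

/-- A finite generating family of the submodule, assembled into one map out of a power of `G`; the
coefficients of a linear combination are the components of a map into that power. -/
lemma exists_power_hom (G X : T) (I : Submodule (End G)ᵐᵒᵖ (G ⟶ X)) (hI : I.FG) :
    ∃ (r : ℕ) (f : power G r ⟶ X), ∀ g : G ⟶ X, g ∈ I ↔ ∃ g', g' ≫ f = g := by
  obtain ⟨r, s, hs⟩ := Submodule.fg_iff_exists_fin_generating_family.1 hI
  refine ⟨r, biproduct.desc s, fun g => ?_⟩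
  rw [← hs, Submodule.mem_span_range_iff_exists_fun]
  constructor
  · rintro ⟨c, rfl⟩
    exact ⟨biproduct.lift fun i => (c i).unop, by rw [biproduct.lift_desc]; rfl⟩
  · rintro ⟨g', rfl⟩
    refine ⟨fun i => op (g' ≫ biproduct.π _ i), ?_⟩
    rw [biproduct.desc_eq, Preadditive.comp_sum]
    refine Finset.sum_congr rfl fun i _ => ?_
    rw [← Category.assoc]
    rfl

namespace IsHeartGenerator

variable {G : T} (hG : IsHeartGenerator G)

include hG

lemma isZero {X : T} (h₁ : ExtLE G (-1) X) (h₂ : ExtGE G 0 X) : IsZero X :=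
  (IsZero.iff_id_eq_zero X).2 (hG.orth h₁ h₂ _)

lemma extLE_self : ExtLE G 0 G := fun i hi => hG.self i (by lia)

/-- An object of the aisle is covered by a power of the generator. -/
lemma exists_cover {X : T} (hX : ExtLE G 0 X) :
    ∃ (r : ℕ) (V : T) (f : power G r ⟶ X) (g : X ⟶ V) (h : V ⟶ (power G r)⟦(1 : ℤ)⟧),
      Triangle.mk f g h ∈ (distTriang T) ∧ ExtLE G (-1) V := by
  have := hG.isNoetherian X
  obtain ⟨r, f, hf⟩ := exists_power_hom G X ⊤ (IsNoetherian.noetherian ⊤)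
  obtain ⟨V, g, h, hT⟩ := distinguished_cocone_triangle f
  refine ⟨r, V, f, g, h, hT, fun i hi => ?_⟩
  -- In degree 0 a map from `G` to the cone lifts to `X`, because Hom(G, G^r⟦1⟧) = 0, and then
  -- through `f`, which hits all of Hom(G, X); so it is zero.
  obtain rfl | hi := (show 0 ≤ i by lia).eq_or_lt
  · rw [extVanish_zero_iff]
    intro φ
    obtain ⟨ψ, rfl⟩ := Triangle.coyoneda_exact₃ _ hT φ ((hG.self 1 (by simp)).power r _)
    obtain ⟨ψ', rfl⟩ := (hf ψ).1 trivial
    exact comp_comp_eq_zero ψ' (comp_distTriang_mor_zero₁₂ _ hT)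
  · exact ExtVanish.ext₃ hT rfl (hX i hi) ((hG.self _ (by lia)).power r)

/-- The quotient, in the heart, of the generator by a right ideal of its endomorphism ring. -/
lemma exists_quotient (I : Submodule (End G)ᵐᵒᵖ (G ⟶ G)) :
    ∃ (Y : T) (p : G ⟶ Y), ExtGE G 0 Y ∧ ExtLE G 0 Y ∧ (∀ g : G ⟶ Y, ∃ l, l ≫ p = g) ∧
      (∀ l : G ⟶ G, l ≫ p = 0 ↔ l ∈ I) ∧
      ∀ (V : T), ExtGE G 0 V → ∀ f : G ⟶ V, (∀ l ∈ I, l ≫ f = 0) → ∃ y : Y ⟶ V, p ≫ y = f := by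
  have := hG.isNoetherian G
  obtain ⟨r, e, he⟩ := exists_power_hom G G I (IsNoetherian.noetherian I)
  obtain ⟨C, c, d, hC⟩ := distinguished_cocone_triangle e
  -- The cokernel in the heart is the zeroth cohomology of the cone: the cone already lies in the
  -- aisle, so only its part in degrees below 0 is removed.
  obtain ⟨U, Y, a, b, t, hY, hU, hY0⟩ := hG.exists_trunc C
  have hec : e ≫ c = 0 := comp_distTriang_mor_zero₁₂ _ hC
  refine ⟨Y, c ≫ b, hY0, fun i hi => ?_, fun g => ?_, fun l => ⟨fun hl => ?_, fun hl => ?_⟩,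
    fun V hV f hf => ?_⟩
  · exact ExtVanish.ext₃ hY rfl (ExtVanish.ext₃ hC rfl (hG.extLE_self i hi)
      ((hG.extLE_self _ (by lia)).power r)) (hU _ (by lia))
  · obtain ⟨g₁, rfl⟩ := Triangle.coyoneda_exact₃ _ hY g (hU 1 (by simp) _)
    obtain ⟨l, rfl⟩ := Triangle.coyoneda_exact₃ _ hC g₁ ((hG.self 1 (by simp)).power r _)
    exact ⟨l, (Category.assoc _ _ _).symm⟩
  · obtain ⟨x, hx⟩ := Triangle.coyoneda_exact₂ _ hY (l ≫ c) ((Category.assoc _ _ _).trans hl)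
    rw [extVanish_zero_iff.1 (hU 0 (by simp)) x] at hx
    obtain ⟨y, hy⟩ := Triangle.coyoneda_exact₂ _ hC l (hx.trans zero_comp)
    exact (he l).2 ⟨y, hy.symm⟩
  · obtain ⟨g', rfl⟩ := (he l).1 hl
    simp [reassoc_of% hec]
  · have hef : e ≫ f = 0 := by
      refine biproduct.hom_ext' _ _ fun j => ?_
      rw [comp_zero, ← Category.assoc]
      exact hf _ ((he _).2 ⟨_, rfl⟩)
    obtain ⟨f₁, rfl⟩ := Triangle.yoneda_exact₂ _ hC f hef
    obtain ⟨y, hy⟩ := Triangle.yoneda_exact₂ _ hY f₁ (hG.orth hU hV _)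
    exact ⟨y, by rw [hy]; exact Category.assoc _ _ _⟩

/-! ### Bounds for triangle functors on the aisle -/

section Functor

variable {T' : Type w} [Category.{w'} T'] [Preadditive T'] [HasZeroObject T'] [HasShift T' ℤ]
  [∀ n : ℤ, (shiftFunctor T' n).Additive] [Pretriangulated T'] {G' : T'}
  (F : T ⥤ T') [F.CommShift ℤ] [F.IsTriangulated]

omit hG in
lemma _root_.GorensteinDerived.extLE_map_shift_iff {X : T} {a n m : ℤ} (h : a + n = m) :
    ExtLE G' n (F.obj (X⟦a⟧)) ↔ ExtLE G' m (F.obj X) := by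
  rw [← extLE_shift_iff h]
  exact ⟨fun H => H.of_iso ((F.commShiftIso a).app X),
    fun H => H.of_iso ((F.commShiftIso a).app X).symm⟩

variable (hG' : IsHeartGenerator G')

include hG'

/-- Induction on the length of Hom(G, V): each nonzero heart object contains one of finitely many
quotients of `G`, and its cokernel is shorter. The bound is the largest one needed for these
finitely many quotients. -/
lemma exists_extLE_map_of_heart :
    ∃ N : ℤ, ∀ V : T, ExtGE G 0 V → ExtLE G 0 V → ExtLE G' N (F.obj V) := by
  have := hG.isNoetherian
  have := hG.isArtinian
  have hfl (X : T) : IsFiniteLength (End G)ᵐᵒᵖ (G ⟶ X) :=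
    isFiniteLength_iff_isNoetherian_isArtinian.2 ⟨inferInstance, inferInstance⟩
  obtain ⟨s, hs, hs'⟩ := exists_finite_annihilators (hfl G)
  let toEnd : (G ⟶ G) →ₗ[(End G)ᵐᵒᵖ] (End G)ᵐᵒᵖ :=
    { toFun := op
      map_add' := fun _ _ => rfl
      map_smul' := fun _ _ => rfl }
  choose Y p hY₀ hY₁ hp hp' hY using fun I : Submodule (End G)ᵐᵒᵖ (End G)ᵐᵒᵖ =>
    hG.exists_quotient (I.comap toEnd)
  choose a N hN using fun I => hG'.bounded (F.obj (Y I))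
  obtain ⟨N₀, hN₀⟩ := (hs.image N).bddAbove
  refine ⟨N₀, ?_⟩
  suffices ∀ (k : ℕ) (V : T), Module.length (End G)ᵐᵒᵖ (G ⟶ V) = k → ExtGE G 0 V →
      ExtLE G 0 V → ExtLE G' N₀ (F.obj V) by
    intro V
    obtain ⟨k, hk⟩ := ENat.ne_top_iff_exists.1 (Module.length_ne_top_iff.2 (hfl V))
    exact this k V hk.symm
  intro k
  induction k using Nat.strong_induction_on with
  | _ k ih =>
  intro V hk hV₀ hV₁
  by_cases hV : ∀ f : G ⟶ V, f = 0
  · have hz : IsZero V := hG.isZero (fun i hi => by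
      obtain rfl | hi := (show 0 ≤ i by lia).eq_or_lt
      · exact extVanish_zero_iff.2 hV
      · exact hV₁ i hi) hV₀
    exact fun i hi f => ((shiftFunctor T' i).map_isZero (F.map_isZero hz)).eq_of_tgt _ _
  push Not at hV
  obtain ⟨x, hx⟩ := hV
  let φ : (G ⟶ G) →ₗ[(End G)ᵐᵒᵖ] (G ⟶ V) :=
    { toFun := fun l => l ≫ x
      map_add' := fun _ _ => Preadditive.add_comp _ _ _ _ _ _
      map_smul' := fun _ _ => Category.assoc _ _ _ }
  -- The given `x` may have an arbitrary annihilator; it is replaced by a `y` whose annihilator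
  -- belongs to the finite list.
  obtain ⟨y, hy, hys⟩ := hs' (G ⟶ V) φ (fun h => hx (by
    have := LinearMap.congr_fun h (𝟙 G)
    simpa [φ] using this))
  set I := LinearMap.ker (LinearMap.toSpanSingleton (End G)ᵐᵒᵖ (G ⟶ V) y) with hI
  have hmem (l : G ⟶ G) : l ∈ I.comap toEnd ↔ l ≫ y = 0 := Iff.rfl
  obtain ⟨j, hj⟩ := hY I V hV₀ y fun l hl => (hmem l).1 hl
  obtain ⟨V', q, t, hT⟩ := distinguished_cocone_triangle j
  -- The quotient was taken by the exact annihilator of `y`, so `j` is a monomorphism in the heart.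
  -- This keeps the cone `V'` in the heart.
  have hinj (g : G ⟶ Y I) (hg : g ≫ j = 0) : g = 0 := by
    obtain ⟨l, rfl⟩ := hp I g
    rw [Category.assoc, hj, ← hmem, ← hp'] at hg
    exact hg
  have hV'₀ : ExtGE G 0 V' := fun i hi => by
    obtain rfl | hi' := (show i ≤ -1 by lia).eq_or_lt
    · have h0 : ExtVanish G (V⟦(-1 : ℤ)⟧) 0 := (extVanish_shift_iff rfl).2 (hV₀ _ (by lia))
      refine (extVanish_shift_iff (show (-1 : ℤ) + 0 = -1 by simp)).1
        (extVanish_zero_iff.2 fun g => ?_)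
      have hT' := inv_rot_of_distTriang _ hT
      have h1 : g ≫ (Triangle.mk j q t).invRotate.mor₁ = 0 :=
        hinj _ (comp_comp_eq_zero g (comp_distTriang_mor_zero₁₂ _ hT'))
      obtain ⟨g', hg'⟩ := Triangle.coyoneda_exact₂ _ (inv_rot_of_distTriang _ hT') g h1
      rw [hg', extVanish_zero_iff.1 h0 g']
      exact zero_comp
    · exact ExtVanish.ext₃ hT rfl (hV₀ i hi) (hY₀ I _ (by lia))
  have hV'₁ : ExtLE G 0 V' := fun i hi => ExtVanish.ext₃ hT rfl (hV₁ i hi) (hY₁ I _ (by lia))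
  have hlen : Module.length (End G)ᵐᵒᵖ (G ⟶ V) =
      Module.length (End G)ᵐᵒᵖ (G ⟶ Y I) + Module.length (End G)ᵐᵒᵖ (G ⟶ V') := by
    refine Module.length_eq_add_of_exact
      ({ toFun := fun l => l ≫ j
         map_add' := fun _ _ => Preadditive.add_comp _ _ _ _ _ _
         map_smul' := fun _ _ => Category.assoc _ _ _ } : (G ⟶ Y I) →ₗ[(End G)ᵐᵒᵖ] (G ⟶ V))
      ({ toFun := fun l => l ≫ q
         map_add' := fun _ _ => Preadditive.add_comp _ _ _ _ _ _
         map_smul' := fun _ _ => Category.assoc _ _ _ } : (G ⟶ V) →ₗ[(End G)ᵐᵒᵖ] (G ⟶ V'))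
      ((injective_iff_map_eq_zero _).2 hinj) (fun g => ?_) (fun g => ⟨fun hg => ?_, ?_⟩)
    · obtain ⟨g', hg'⟩ := Triangle.coyoneda_exact₃ _ hT g (hY₁ I 1 (by simp) _)
      exact ⟨g', hg'.symm⟩
    · obtain ⟨g', hg'⟩ := Triangle.coyoneda_exact₂ _ hT g hg
      exact ⟨g', hg'.symm⟩
    · rintro ⟨g', rfl⟩
      exact comp_comp_eq_zero g' (comp_distTriang_mor_zero₁₂ _ hT)
  obtain ⟨k₁, hk₁⟩ := ENat.ne_top_iff_exists.1 (Module.length_ne_top_iff.2 (hfl (Y I)))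
  obtain ⟨k₂, hk₂⟩ := ENat.ne_top_iff_exists.1 (Module.length_ne_top_iff.2 (hfl V'))
  have hpos : k₁ ≠ 0 := by
    rintro rfl
    have : Subsingleton (G ⟶ Y I) := Module.length_eq_zero_iff.1 hk₁.symm
    rw [Subsingleton.elim (p I) 0, zero_comp] at hj
    exact hy hj.symm
  rw [hk, ← hk₁, ← hk₂] at hlen
  norm_cast at hlen
  have hV' := ih k₂ (by lia) V' hk₂.symm hV'₀ hV'₁
  have hFT := F.map_distinguished _ hT
  have hYI : ExtLE G' N₀ (F.obj (Y I)) := (hN I).2.mono (hN₀ ⟨I, hys, rfl⟩)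
  exact fun i hi => ExtVanish.ext₂ hFT (hYI i hi) (hV' i hi)

/-- Induction on the amplitude: the top cohomology is bounded by the heart case, and the rest,
shifted by -1 back into the aisle, has smaller amplitude. -/
lemma exists_extLE_map : ∃ N : ℤ, ∀ V : T, ExtLE G 0 V → ExtLE G' N (F.obj V) := by
  obtain ⟨N, hN⟩ := hG.exists_extLE_map_of_heart F hG'
  refine ⟨N, ?_⟩
  suffices ∀ (k : ℕ) (V : T), ExtGE G (-k) V → ExtLE G 0 V → ExtLE G' N (F.obj V) by
    intro V hV
    obtain ⟨a, b, ha, -⟩ := hG.bounded V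
    exact this a.natAbs V (fun i hi => ha i (by lia)) hV
  intro k
  induction k with
  | zero => exact fun V h₀ h₁ => hN V (by simpa using h₀) h₁
  | succ k ih =>
    intro V h₀ h₁
    obtain ⟨U, C, f, g, h, hT, hU, hC⟩ := hG.exists_trunc V
    have hC₁ : ExtLE G 0 C := fun i hi => ExtVanish.ext₃ hT rfl (h₁ i hi) (hU _ (by lia))
    have hU₀ : ExtGE G (-(k + 1 : ℕ)) U := fun i hi =>
      ExtVanish.ext₁ hT (i := i - 1) (by lia) (hC _ (by lia)) (h₀ i hi)
    have hU' := ih (U⟦(-1 : ℤ)⟧) ((extGE_shift_iff (by push_cast; lia)).2 hU₀)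
      ((extLE_shift_iff (by lia)).2 hU)
    rw [extLE_map_shift_iff F rfl] at hU'
    exact fun i hi => ExtVanish.ext₂ (F.map_distinguished _ hT) (hU' i (by lia))
      (hN C hC hC₁ i hi)

/-- A triangle functor which maps the generator of the heart into `Hom(G', -⟦i⟧) = 0` for `i > b`
does so with the entire aisle. -/
lemma extLE_map {b : ℤ} (hb : ExtLE G' b (F.obj G)) {V : T} (hV : ExtLE G 0 V) :
    ExtLE G' b (F.obj V) := by
  obtain ⟨N, hN⟩ := hG.exists_extLE_map F hG'
  suffices ∀ (k : ℕ), (∀ V : T, ExtLE G 0 V → ExtLE G' (b + k) (F.obj V)) →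
      ∀ V : T, ExtLE G 0 V → ExtLE G' b (F.obj V) from
    this (N - b).natAbs (fun V hV => (hN V hV).mono (by lia)) V hV
  intro k
  induction k with
  | zero => exact fun h V hV => by simpa using h V hV
  | succ k ih =>
    refine fun H => ih fun V hV => ?_
    obtain ⟨r, W, f, g, h, hT, hW⟩ := hG.exists_cover hV
    -- The weak bound b + k + 1 applied to the shift of `W` gives b + k for `W` itself. The power of
    -- `G` already satisfies b, so `V` inherits b + k.
    have hW' := H (W⟦(-1 : ℤ)⟧) ((extLE_shift_iff (by lia)).2 hW)
    rw [extLE_map_shift_iff F rfl] at hW'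
    have hP : ExtLE G' b (F.obj (power G r)) :=
      (hb.power r).of_iso (F.mapBiproduct _).symm
    exact fun i hi => ExtVanish.ext₂ (F.map_distinguished _ hT) (hP i (by lia))
      (hW' i (by push_cast; lia))

end Functor

/-! ### Image of the generator under the inverse equivalence -/

section Equivalence

variable {T' : Type w} [Category.{w'} T'] [Preadditive T'] [HasZeroObject T'] [HasShift T' ℤ]
  [∀ n : ℤ, (shiftFunctor T' n).Additive] [Pretriangulated T'] {G' : T'}
  (F : T ≌ T') [F.functor.CommShift ℤ] [F.functor.IsTriangulated] (hG' : IsHeartGenerator G')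

include hG'

-- Under the equivalence, maps from `G` to a shift of the image of `G'` by i become maps from the
-- image of `G` to `G'⟦i⟧`, which lies in degree -i and hence in degrees at most a - 1 once i > -a.
omit hG in
lemma extLE_inverse_obj {a : ℤ} (ha : ∀ W : T', ExtLE G' (a - 1) W →
    ∀ f : F.functor.obj G ⟶ W, f = 0) : ExtLE G (-a) (F.inverse.obj G') := fun i hi f => by
  refine F.functor.map_injective ?_
  rw [Functor.map_zero]
  refine ha _ ?_ _
  rw [extLE_map_shift_iff F.functor rfl]
  exact (hG'.extLE_self.mono (by lia)).of_iso (F.counitIso.app G').symm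

/-- Transporting along the equivalence gives maps from `G'` to the image of `W`. The bound on the
whole aisle puts that image in degrees at most -1, where `G'` sees nothing. -/
lemma hom_inverse_obj_eq_zero {b : ℤ} (hb : ExtLE G' b (F.functor.obj G)) {W : T}
    (hW : ExtLE G (-b - 1) W) (f : F.inverse.obj G' ⟶ W) : f = 0 := by
  refine F.functor.map_injective ?_
  have h := hG.extLE_map F.functor hG' hb ((extLE_shift_iff (a := -b - 1) (by simp)).2 hW)
  rw [extLE_map_shift_iff F.functor rfl] at h
  rw [Functor.map_zero, ← cancel_epi (F.counitIso.inv.app G'), comp_zero]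
  exact extVanish_zero_iff.1 (h 0 (by lia)) _

end Equivalence

end IsHeartGenerator

end Triangulated

/-! ### Two-sided chains -/

section IntSequence

/-- A relation which is total in both directions admits two-sided infinite chains. -/
lemma exists_int_chain {α : Type u} (r : α → α → Prop) (h₁ : ∀ x, ∃ y, r x y)
    (h₂ : ∀ y, ∃ x, r x y) (x : α) : ∃ f : ℤ → α, f 0 = x ∧ ∀ n, r (f n) (f (n + 1)) := by
  choose next hnext using h₁
  choose prev hprev using h₂
  refine ⟨fun n => match n with
    | Int.ofNat k => next^[k] x
    | Int.negSucc k => prev^[k + 1] x, rfl, fun n => ?_⟩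
  match n with
  | Int.ofNat k =>
    change r (next^[k] x) (next^[k + 1] x)
    rw [Function.iterate_succ_apply']
    exact hnext _
  | Int.negSucc 0 => exact hprev x
  | Int.negSucc (k + 1) =>
    change r (prev^[k + 1 + 1] x) (prev^[k + 1] x)
    rw [Function.iterate_succ_apply' prev (k + 1)]
    exact hprev _

end IntSequence

/-! ### Gorenstein projective objects of an abelian category -/

section GorensteinClass

open Abelian

variable {C : Type u} [Category.{v} C] [Abelian C]

/-- A totally acyclic complex of projective objects. -/
structure TotallyAcyclic (K : CochainComplex C ℤ) : Prop where
  projective : ∀ i, Projective (K.X i)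
  acyclic : K.Acyclic
  hom_exact : ∀ Q : C, Projective Q → ∀ i j k : ℤ, i + 1 = j → j + 1 = k →
    ∀ f : K.X j ⟶ Q, K.d i j ≫ f = 0 → ∃ g : K.X k ⟶ Q, K.d j k ≫ g = f

variable (C) in
/-- The Gorenstein projective objects: the syzygies of totally acyclic complexes. -/
def gorensteinProjective : ObjectProperty C := fun X =>
  ∃ (K : CochainComplex C ℤ) (n : ℤ), TotallyAcyclic K ∧ Nonempty (X ≅ kernel (K.d n (n + 1)))

instance : (gorensteinProjective C).IsClosedUnderIsomorphisms where
  of_iso := by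
    rintro X Y e ⟨K, n, hK, ⟨e'⟩⟩
    exact ⟨K, n, hK, ⟨e.symm ≪≫ e'⟩⟩

/-- A class of objects on which extensions by projectives vanish and which has enough
projectives and enough embeddings into projectives, with (co)kernels in the class. -/
structure IsGorensteinClass [HasExt.{w} C] (P : ObjectProperty C) : Prop where
  ext_eq_zero : ∀ X, P X → ∀ Q : C, Projective Q → ∀ e : Ext.{w} X Q 1, e = 0
  exists_right : ∀ X, P X → ∃ (Y Z : C) (f : X ⟶ Y) (g : Y ⟶ Z) (h : f ≫ g = 0),
    (ShortComplex.mk f g h).ShortExact ∧ Projective Y ∧ P Z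
  exists_left : ∀ X, P X → ∃ (Y Z : C) (f : Z ⟶ Y) (g : Y ⟶ X) (h : f ≫ g = 0),
    (ShortComplex.mk f g h).ShortExact ∧ Projective Y ∧ P Z

lemma exact_comp_epi_comp_mono {W X Y Z V : C} {f : X ⟶ Y} {g : Y ⟶ Z} {h : f ≫ g = 0}
    (hfg : (ShortComplex.mk f g h).Exact) (p : W ⟶ X) [Epi p] (i : Z ⟶ V) [Mono i]
    (h' : (p ≫ f) ≫ g ≫ i = 0) : (ShortComplex.mk (p ≫ f) (g ≫ i) h').Exact := by
  rw [ShortComplex.exact_iff_exact_up_to_refinements] at hfg ⊢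
  intro A x hx
  obtain ⟨A', π, _, y, hy⟩ := hfg x (by
    rw [← cancel_mono i, Category.assoc, zero_comp]
    exact hx)
  obtain ⟨A'', π', _, z, hz⟩ := surjective_up_to_refinements_of_epi p y
  refine ⟨A'', π' ≫ π, inferInstance, z, ?_⟩
  dsimp at hy ⊢
  rw [Category.assoc, hy, reassoc_of% hz]

lemma exists_extension_of_ext_eq_zero [HasExt.{w} C] {S : ShortComplex C} (hS : S.ShortExact)
    {Q : C} (h : ∀ e : Ext.{w} S.X₃ Q 1, e = 0) (f : S.X₁ ⟶ Q) :
    ∃ g : S.X₂ ⟶ Q, S.f ≫ g = f := by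
  obtain ⟨x, hx⟩ := Ext.contravariant_sequence_exact₁ hS Q (Ext.mk₀ f) (add_zero 1) (h _)
  obtain ⟨g, rfl⟩ := Ext.mk₀_bijective _ _ |>.2 x
  refine ⟨g, (Ext.mk₀_bijective _ _).1 ?_⟩
  rw [← hx, Ext.mk₀_comp_mk₀]

/-- Splice the short exact sequences of the class in both directions from `X`. Exactness of Hom into
a projective is the vanishing of Ext¹ on the syzygies. -/
lemma IsGorensteinClass.exists_totallyAcyclic [HasExt.{w} C] {P : ObjectProperty C}
    (hP : IsGorensteinClass.{u, v, w} P) {X : C} (hX : P X) :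
    ∃ K : CochainComplex C ℤ, TotallyAcyclic K ∧ Nonempty (X ≅ kernel (K.d 0 1)) := by
  obtain ⟨x, hx0, hx⟩ := exists_int_chain
    (fun x y : Subtype P => ∃ (Y : C) (f : x.1 ⟶ Y) (g : Y ⟶ y.1) (h : f ≫ g = 0),
      (ShortComplex.mk f g h).ShortExact ∧ Projective Y)
    (fun x => by
      obtain ⟨Y, Z, f, g, h, hS, hY, hZ⟩ := hP.exists_right x.1 x.2
      exact ⟨⟨Z, hZ⟩, Y, f, g, h, hS, hY⟩)
    (fun x => by
      obtain ⟨Y, Z, f, g, h, hS, hY, hZ⟩ := hP.exists_left x.1 x.2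
      exact ⟨⟨Z, hZ⟩, Y, f, g, h, hS, hY⟩) ⟨X, hX⟩
  choose Y f g h hS hY using hx
  have hf (n : ℤ) : Mono (f n) := (hS n).mono_f
  have hg (n : ℤ) : Epi (g n) := (hS n).epi_g
  have hd (n : ℤ) : (g n ≫ f (n + 1)) ≫ g (n + 1) ≫ f (n + 1 + 1) = 0 := by
    simp [reassoc_of% (h (n + 1))]
  let K : CochainComplex C ℤ := CochainComplex.of Y (fun n => g n ≫ f (n + 1)) hd
  have hK (n : ℤ) : K.d n (n + 1) = g n ≫ f (n + 1) := CochainComplex.of_d Y (fun n => g n ≫ f (n + 1)) n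
  refine ⟨K, ⟨hY, fun n => ?_, fun Q hQ i j k hij hjk φ hφ => ?_⟩, ⟨?_⟩⟩
  · obtain ⟨n, rfl⟩ : ∃ m, n = m + 1 := ⟨n - 1, by simp⟩
    rw [K.exactAt_iff' n (n + 1) (n + 1 + 1) (by simp) (by simp)]
    have := exact_comp_epi_comp_mono (hS (n + 1)).exact (g n) (f (n + 1 + 1)) (hd n)
    let e : ShortComplex.mk _ _ (hd n) ≅ K.sc' n (n + 1) (n + 1 + 1) :=
      ShortComplex.isoMk (Iso.refl _) (Iso.refl _) (Iso.refl _)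
        ((Category.id_comp _).trans ((hK n).trans (Category.comp_id _).symm))
        ((Category.id_comp _).trans ((hK (n + 1)).trans (Category.comp_id _).symm))
    exact ShortComplex.exact_of_iso e this
  · subst hij hjk
    have h0 : f (i + 1) ≫ φ = 0 := by
      rw [hK] at hφ
      rw [← cancel_epi (g i), comp_zero, ← Category.assoc]
      exact hφ
    -- The cocycle descends to the syzygy in degree i + 2, and then extends along its embedding into
    -- the next projective since Ext¹ of the following syzygy vanishes.
    obtain ⟨ψ, hψ⟩ := CokernelCofork.IsColimit.desc' (hS (i + 1)).gIsCokernel φ h0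
    obtain ⟨χ, hχ⟩ := exists_extension_of_ext_eq_zero (hS (i + 1 + 1))
      (hP.ext_eq_zero _ (x _).2 Q hQ) ψ
    refine ⟨χ, ?_⟩
    rw [hK, Category.assoc]
    exact (congrArg _ hχ).trans hψ
  · have e : X ≅ (x 0).1 := eqToIso (by rw [hx0])
    have hlim := isKernelCompMono (hS 0).fIsKernel (f 1) (h := K.d 0 1) (hK 0)
    exact e ≪≫ hlim.conePointUniqueUpToIso (limit.isLimit _)

lemma IsGorensteinClass.gorensteinProjective [HasExt.{w} C] {P : ObjectProperty C}
    (hP : IsGorensteinClass.{u, v, w} P) {X : C} (hX : P X) : gorensteinProjective C X := by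
  obtain ⟨K, hK, e⟩ := hP.exists_totallyAcyclic hX
  exact ⟨K, 0, hK, e⟩

lemma TotallyAcyclic.shortExact {K : CochainComplex C ℤ} (hK : TotallyAcyclic K) (n : ℤ) :
    (ShortComplex.mk (kernel.ι (K.d n (n + 1)))
      (kernel.lift (K.d (n + 1) (n + 1 + 1)) (K.d n (n + 1)) (K.d_comp_d _ _ _))
      (by rw [← cancel_mono (kernel.ι _)]; simp)).ShortExact where
  exact := by
    rw [ShortComplex.exact_iff_exact_up_to_refinements]
    intro A x hx
    have h : x ≫ K.d n (n + 1) = 0 := by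
      have := congrArg (· ≫ kernel.ι _) hx
      simpa using this
    exact ⟨A, 𝟙 A, inferInstance, kernel.lift _ x h, by simp⟩
  mono_f := by dsimp; infer_instance
  epi_g := by
    have := hK.acyclic (n + 1)
    rw [K.exactAt_iff' n (n + 1) (n + 1 + 1) (by simp) (by simp),
      ShortComplex.exact_iff_epi_kernel_lift] at this
    exact this

lemma gorensteinProjective_isGorensteinClass [HasExt.{w} C] :
    IsGorensteinClass.{u, v, w} (gorensteinProjective C) where
  ext_eq_zero := by
    rintro X ⟨K, n, hK, ⟨e⟩⟩ Q hQ x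
    suffices ∀ y : Ext.{w} (kernel (K.d n (n + 1))) Q 1, y = 0 by
      have h : x = (Ext.mk₀ e.hom).comp ((Ext.mk₀ e.inv).comp x (zero_add 1)) (zero_add 1) := by
        rw [Ext.mk₀_comp_mk₀_assoc, e.hom_inv_id, Ext.mk₀_id_comp]
      rw [h, this ((Ext.mk₀ e.inv).comp x (zero_add 1)), Ext.comp_zero]
    intro y
    -- Two steps to the left are needed: the class is the boundary of a map `z` from the previous
    -- syzygy, and `z` pulled back to the term before that is a cocycle, so by Hom-exactness `z`
    -- extends to the projective and its boundary is zero.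
    obtain ⟨n, rfl⟩ : ∃ m, n = m + 1 + 1 := ⟨n - 2, by lia⟩
    have := hK.projective (n + 1)
    obtain ⟨z, rfl⟩ := Ext.contravariant_sequence_exact₃ (hK.shortExact (n + 1)) Q y
      (Ext.eq_zero_of_projective _) (add_zero 1)
    obtain ⟨z, rfl⟩ := (Ext.mk₀_bijective _ _).2 z
    dsimp at z
    obtain ⟨p, hι, _⟩ : ∃ p : K.X n ⟶ kernel (K.d (n + 1) (n + 1 + 1)),
        p ≫ kernel.ι _ = K.d n (n + 1) ∧ Epi p :=
      ⟨_, kernel.lift_ι _ _ (K.d_comp_d _ _ _), (hK.shortExact n).epi_g⟩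
    have hp : K.d (n - 1) n ≫ p = 0 := by
      rw [← cancel_mono (kernel.ι _), Category.assoc, hι, K.d_comp_d, zero_comp]
    obtain ⟨g, hg⟩ := hK.hom_exact Q hQ (n - 1) n (n + 1) (by simp) rfl (p ≫ z)
      (by rw [← Category.assoc, hp, zero_comp])
    rw [← hι, Category.assoc, cancel_epi] at hg
    rw [← hg, ← Ext.mk₀_comp_mk₀]
    exact (hK.shortExact (n + 1)).extClass_comp_assoc _
  exists_right := by
    rintro X ⟨K, n, hK, ⟨e⟩⟩
    refine ⟨K.X n, kernel (K.d (n + 1) (n + 1 + 1)), e.hom ≫ kernel.ι _,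
      kernel.lift _ _ (K.d_comp_d n (n + 1) (n + 1 + 1)), ?_, ?_, hK.projective n,
      K, n + 1, hK, ⟨Iso.refl _⟩⟩
    · rw [← cancel_mono (kernel.ι _)]; simp
    · refine ShortComplex.shortExact_of_iso ?_ (hK.shortExact n)
      exact ShortComplex.isoMk e.symm (Iso.refl _) (Iso.refl _)
  exists_left := by
    rintro X ⟨K, n, hK, ⟨e⟩⟩
    obtain ⟨n, rfl⟩ : ∃ m, n = m + 1 := ⟨n - 1, by simp⟩
    refine ⟨K.X n, kernel (K.d n (n + 1)), kernel.ι _,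
      kernel.lift _ _ (K.d_comp_d n (n + 1) (n + 1 + 1)) ≫ e.inv, ?_, ?_, hK.projective n,
      K, n, hK, ⟨Iso.refl _⟩⟩
    · rw [← cancel_mono (e.hom ≫ kernel.ι _)]; simp
    · refine ShortComplex.shortExact_of_iso ?_ (hK.shortExact n)
      exact ShortComplex.isoMk (Iso.refl _) (Iso.refl _) e.symm

section Extension

variable {S₁ S₂ : ShortComplex C} (h₁ : S₁.ShortExact) (h₂ : S₂.ShortExact) (φ : S₁ ⟶ S₂)

/-- The snake input of a morphism of short exact sequences. -/
noncomputable def snakeInput : ShortComplex.SnakeInput C where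
  L₀ := kernel φ
  L₁ := S₁
  L₂ := S₂
  L₃ := cokernel φ
  v₀₁ := kernel.ι φ
  v₁₂ := φ
  v₂₃ := cokernel.π φ
  w₀₂ := kernel.condition φ
  w₁₃ := cokernel.condition φ
  h₀ := kernelIsKernel φ
  h₃ := cokernelIsCokernel φ
  L₁_exact := h₁.exact
  epi_L₁_g := h₁.epi_g
  L₂_exact := h₂.exact
  mono_L₂_f := h₂.mono_f

include h₁ h₂

/-- Snake lemma: the third kernel vanishes, so the connecting map is zero and the row of cokernels
is also exact on the left. -/
lemma exists_cokernel_shortExact [Mono φ.τ₁] [Mono φ.τ₃] :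
    ∃ (S₃ : ShortComplex C) (π : S₂ ⟶ S₃) (w₁ : φ.τ₁ ≫ π.τ₁ = 0) (w₂ : φ.τ₂ ≫ π.τ₂ = 0)
      (w₃ : φ.τ₃ ≫ π.τ₃ = 0), S₃.ShortExact ∧
      (ShortComplex.mk φ.τ₁ π.τ₁ w₁).ShortExact ∧ (ShortComplex.mk φ.τ₂ π.τ₂ w₂).ShortExact ∧
      (ShortComplex.mk φ.τ₃ π.τ₃ w₃).ShortExact := by
  let I := snakeInput h₁ h₂ φ
  have : Mono S₁.f := h₁.mono_f
  have : Mono S₂.f := h₂.mono_f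
  have : Epi I.L₂.g := h₂.epi_g
  have : Mono φ.τ₂ := ShortComplex.mono_τ₂_of_exact_of_mono φ h₁.exact
  have hz : I.δ = 0 := by
    have : Mono I.v₁₂.τ₃ := ‹Mono φ.τ₃›
    have h0 : I.v₀₁.τ₃ = 0 := by rw [← cancel_mono I.v₁₂.τ₃, I.w₀₂_τ₃, zero_comp]
    have := I.mono_v₀₁_τ₃
    have : IsZero I.L₀.X₃ := by
      rw [IsZero.iff_id_eq_zero, ← cancel_mono I.v₀₁.τ₃, h0, comp_zero, comp_zero]
    exact this.eq_of_src _ _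
  exact ⟨I.L₃, I.v₂₃, I.w₁₃_τ₁, I.w₁₃_τ₂, I.w₁₃_τ₃,
    { exact := I.L₃_exact, mono_f := (I.L₂'_exact.mono_g_iff).2 hz, epi_g := I.epi_L₃_g },
    { exact := I.exact_C₁_down, mono_f := ‹Mono φ.τ₁›, epi_g := I.epi_v₂₃_τ₁ },
    { exact := I.exact_C₂_down, mono_f := ‹Mono φ.τ₂›, epi_g := I.epi_v₂₃_τ₂ },
    { exact := I.exact_C₃_down, mono_f := ‹Mono φ.τ₃›, epi_g := I.epi_v₂₃_τ₃ }⟩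

/-- Dual snake argument: the first cokernel vanishes, so the row of kernels is also exact on the
right. -/
lemma exists_kernel_shortExact [Epi φ.τ₁] [Epi φ.τ₃] :
    ∃ (S₀ : ShortComplex C) (ι : S₀ ⟶ S₁) (w₁ : ι.τ₁ ≫ φ.τ₁ = 0) (w₂ : ι.τ₂ ≫ φ.τ₂ = 0)
      (w₃ : ι.τ₃ ≫ φ.τ₃ = 0), S₀.ShortExact ∧
      (ShortComplex.mk ι.τ₁ φ.τ₁ w₁).ShortExact ∧ (ShortComplex.mk ι.τ₂ φ.τ₂ w₂).ShortExact ∧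
      (ShortComplex.mk ι.τ₃ φ.τ₃ w₃).ShortExact := by
  let I := snakeInput h₁ h₂ φ
  have : Epi S₁.g := h₁.epi_g
  have : Epi S₂.g := h₂.epi_g
  have : Mono I.L₁.f := h₁.mono_f
  have : Epi φ.τ₂ := ShortComplex.epi_τ₂_of_exact_of_epi φ h₂.exact
  have hz : I.δ = 0 := by
    have : Epi I.v₁₂.τ₁ := ‹Epi φ.τ₁›
    have h0 : I.v₂₃.τ₁ = 0 := by rw [← cancel_epi I.v₁₂.τ₁, I.w₁₃_τ₁, comp_zero]
    have := I.epi_v₂₃_τ₁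
    have : IsZero I.L₃.X₁ := by
      rw [IsZero.iff_id_eq_zero, ← cancel_epi I.v₂₃.τ₁, h0, zero_comp, zero_comp]
    exact this.eq_of_tgt _ _
  exact ⟨I.L₀, I.v₀₁, I.w₀₂_τ₁, I.w₀₂_τ₂, I.w₀₂_τ₃,
    { exact := I.L₀_exact, mono_f := I.mono_L₀_f, epi_g := (I.L₁'_exact.epi_f_iff).2 hz },
    { exact := I.exact_C₁_up, mono_f := I.mono_v₀₁_τ₁, epi_g := ‹Epi φ.τ₁› },
    { exact := I.exact_C₂_up, mono_f := I.mono_v₀₁_τ₂, epi_g := ‹Epi φ.τ₂› },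
    { exact := I.exact_C₃_up, mono_f := I.mono_v₀₁_τ₃, epi_g := ‹Epi φ.τ₃› }⟩

end Extension

variable (C) in
/-- The extensions of Gorenstein projective objects by such. -/
def gorensteinExtension : ObjectProperty C := fun X =>
  ∃ S : ShortComplex C, S.ShortExact ∧ gorensteinProjective C S.X₁ ∧
    gorensteinProjective C S.X₃ ∧ S.X₂ = X

lemma biprod_shortExact (X Y : C) :
    (ShortComplex.mk (biprod.inl : X ⟶ X ⊞ Y) biprod.snd (by simp)).ShortExact :=
  (ShortComplex.Splitting.ofHasBinaryBiproduct X Y).shortExact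

/-- Horseshoe lemma on both sides. To the left it uses projectivity; to the right, extending the
embedding of the subobject to the middle term uses Ext¹ vanishing into projectives. -/
lemma gorensteinExtension_isGorensteinClass [HasExt.{w} C] :
    IsGorensteinClass.{u, v, w} (gorensteinExtension C) where
  ext_eq_zero := by
    rintro _ ⟨S, hS, h₁, h₃, rfl⟩ Q hQ x
    have hC := gorensteinProjective_isGorensteinClass.{u, v, w} (C := C)
    obtain ⟨y, rfl⟩ := Ext.contravariant_sequence_exact₂ hS Q x (hC.ext_eq_zero _ h₁ Q hQ _)
    rw [hC.ext_eq_zero _ h₃ Q hQ y, Ext.comp_zero]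
  exists_right := by
    rintro _ ⟨S, hS, h₁, h₃, rfl⟩
    have hC := gorensteinProjective_isGorensteinClass.{u, v, w} (C := C)
    obtain ⟨P₁, Z₁, i₁, p₁, w₁, hS₁, hP₁, hZ₁⟩ := hC.exists_right _ h₁
    obtain ⟨P₃, Z₃, i₃, p₃, w₃, hS₃, hP₃, hZ₃⟩ := hC.exists_right _ h₃
    obtain ⟨j, hj⟩ := exists_extension_of_ext_eq_zero hS (hC.ext_eq_zero _ h₃ P₁ hP₁) i₁
    let φ : S ⟶ ShortComplex.mk (biprod.inl : P₁ ⟶ P₁ ⊞ P₃) biprod.snd (by simp) :=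
      { τ₁ := i₁
        τ₂ := biprod.lift j (S.g ≫ i₃)
        τ₃ := i₃
        comm₁₂ := by
          dsimp
          ext <;> simp [hj]
        comm₂₃ := by simp }
    have : Mono φ.τ₁ := hS₁.mono_f
    have : Mono φ.τ₃ := hS₃.mono_f
    obtain ⟨S', π, q₁, q₂, q₃, hS', hq₁, hq₂, hq₃⟩ :=
      exists_cokernel_shortExact hS (biprod_shortExact P₁ P₃) φ
    refine ⟨P₁ ⊞ P₃, S'.X₂, φ.τ₂, π.τ₂, q₂, hq₂, inferInstance, S', hS', ?_, ?_, rfl⟩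
    · exact ObjectProperty.prop_of_iso _
        (hS₁.gIsCokernel.coconePointUniqueUpToIso hq₁.gIsCokernel) hZ₁
    · exact ObjectProperty.prop_of_iso _
        (hS₃.gIsCokernel.coconePointUniqueUpToIso hq₃.gIsCokernel) hZ₃
  exists_left := by
    rintro _ ⟨S, hS, h₁, h₃, rfl⟩
    have hC := gorensteinProjective_isGorensteinClass.{u, v, w} (C := C)
    obtain ⟨P₁, Z₁, i₁, p₁, w₁, hS₁, hP₁, hZ₁⟩ := hC.exists_left _ h₁
    obtain ⟨P₃, Z₃, i₃, p₃, w₃, hS₃, hP₃, hZ₃⟩ := hC.exists_left _ h₃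
    have := hS.epi_g
    let j := Projective.factorThru p₃ S.g
    have hj : j ≫ S.g = p₃ := Projective.factorThru_comp _ _
    let φ : ShortComplex.mk (biprod.inl : P₁ ⟶ P₁ ⊞ P₃) biprod.snd (by simp) ⟶ S :=
      { τ₁ := p₁
        τ₂ := biprod.desc (p₁ ≫ S.f) j
        τ₃ := p₃
        comm₁₂ := by simp
        comm₂₃ := by
          dsimp
          ext <;> simp [hj] }
    have : Epi φ.τ₁ := hS₁.epi_g
    have : Epi φ.τ₃ := hS₃.epi_g
    obtain ⟨S', ι, q₁, q₂, q₃, hS', hq₁, hq₂, hq₃⟩ :=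
      exists_kernel_shortExact (biprod_shortExact P₁ P₃) hS φ
    refine ⟨P₁ ⊞ P₃, S'.X₂, ι.τ₂, φ.τ₂, q₂, hq₂, inferInstance, S', hS', ?_, ?_, rfl⟩
    · exact ObjectProperty.prop_of_iso _
        (hS₁.fIsKernel.conePointUniqueUpToIso hq₁.fIsKernel) hZ₁
    · exact ObjectProperty.prop_of_iso _
        (hS₃.fIsKernel.conePointUniqueUpToIso hq₃.fIsKernel) hZ₃

/-- Gorenstein projective objects are closed under extensions. -/
lemma gorensteinProjective_of_shortExact [HasExt.{w} C] {S : ShortComplex C} (hS : S.ShortExact)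
    (h₁ : gorensteinProjective C S.X₁) (h₃ : gorensteinProjective C S.X₃) :
    gorensteinProjective C S.X₂ :=
  gorensteinExtension_isGorensteinClass.{u, v, w}.gorensteinProjective ⟨S, hS, h₁, h₃, rfl⟩

lemma gorensteinProjective_biprod [HasExt.{w} C] {X Y : C} (hX : gorensteinProjective C X)
    (hY : gorensteinProjective C Y) : gorensteinProjective C (X ⊞ Y) :=
  gorensteinProjective_of_shortExact.{u, v, w} (biprod_shortExact X Y) hX hY

variable (C) in
/-- The direct summands of Gorenstein projective objects. -/
def gorensteinSummand : ObjectProperty C := fun X => ∃ Y, gorensteinProjective C (X ⊞ Y)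

/-- For X ⊞ N embedded in P with cokernel Z, the cokernel C of X → P is an extension of Z by N.
Adding X to both N and C gives 0 → X ⊞ N → C ⊞ X → Z → 0, so C ⊞ X is Gorenstein projective and C is
again a summand. Kernels are treated dually. -/
lemma gorensteinSummand_isGorensteinClass [HasExt.{w} C] :
    IsGorensteinClass.{u, v, w} (gorensteinSummand C) where
  ext_eq_zero := by
    rintro X ⟨N, hN⟩ Q hQ x
    have hC := gorensteinProjective_isGorensteinClass.{u, v, w} (C := C)
    have h : x = (Ext.mk₀ (biprod.inl : X ⟶ X ⊞ N)).comp
        ((Ext.mk₀ biprod.fst).comp x (zero_add 1)) (zero_add 1) := by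
      rw [Ext.mk₀_comp_mk₀_assoc, biprod.inl_fst, Ext.mk₀_id_comp]
    rw [h, hC.ext_eq_zero _ hN Q hQ ((Ext.mk₀ biprod.fst).comp x (zero_add 1)), Ext.comp_zero]
  exists_right := by
    rintro X ⟨N, hN⟩
    have hC := gorensteinProjective_isGorensteinClass.{u, v, w} (C := C)
    obtain ⟨P, Z, j, q, w, hS, hP, hZ⟩ := hC.exists_right _ hN
    have hj : Mono j := hS.mono_f
    have hq : Epi q := hS.epi_g
    let π := cokernel.π (biprod.inl ≫ j)
    have hπ : (ShortComplex.mk (biprod.inl ≫ j) π (cokernel.condition _)).Exact :=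
      ShortComplex.exact_cokernel _
    let β : cokernel (biprod.inl ≫ j) ⟶ Z := cokernel.desc _ q (by rw [Category.assoc, w, comp_zero])
    have hβ : π ≫ β = q := cokernel.π_desc _ _ _
    have : Epi β := epi_of_epi_fac hβ
    let α : N ⟶ cokernel (biprod.inl ≫ j) := biprod.inr ≫ j ≫ π
    have hαβ : α ≫ β = 0 := by simp [α, hβ, w]
    -- This and the next claim say that 0 → N → C → Z → 0 is left exact at N and exact in the
    -- middle.
    have hα {A : C} (n : A ⟶ N) (hn : n ≫ α = 0) : n = 0 := by
      obtain ⟨A', ρ, _, x, hx⟩ := hπ.exact_up_to_refinements (n ≫ biprod.inr ≫ j) (by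
        simpa [α] using hn)
      dsimp at hx
      rw [← cancel_epi ρ, comp_zero]
      have h2 : ρ ≫ n ≫ biprod.inr = x ≫ biprod.inl := by
        rw [← cancel_mono j]
        simpa using hx
      have := congrArg (· ≫ biprod.snd) h2
      simpa using this
    have hex {A : C} (x : A ⟶ cokernel (biprod.inl ≫ j)) (hx : x ≫ β = 0) :
        ∃ (A' : C) (ρ : A' ⟶ A) (_ : Epi ρ) (n : A' ⟶ N), ρ ≫ x = n ≫ α := by
      obtain ⟨A', ρ, _, p, hp⟩ := surjective_up_to_refinements_of_epi π x
      obtain ⟨A'', ρ', _, y, hy⟩ := hS.exact.exact_up_to_refinements p (by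
        change p ≫ q = 0
        rw [← hβ, ← Category.assoc, ← hp, Category.assoc, hx, comp_zero])
      dsimp at hy
      refine ⟨A'', ρ' ≫ ρ, inferInstance, y ≫ biprod.snd, ?_⟩
      have h0 : biprod.inl ≫ j ≫ π = 0 := (Category.assoc _ _ _).symm.trans (cokernel.condition _)
      have h1 : j ≫ π = biprod.snd ≫ α := biprod.hom_ext' _ _ (by simp [h0]) (by simp [α])
      rw [Category.assoc, hp, reassoc_of% hy, h1, Category.assoc]
    refine ⟨P, cokernel (biprod.inl ≫ j), biprod.inl ≫ j, π, cokernel.condition _,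
      { exact := hπ, mono_f := mono_comp _ _, epi_g := by dsimp; infer_instance }, hP, X, ?_⟩
    have hT : (ShortComplex.mk (biprod.lift (biprod.snd ≫ α) biprod.fst : X ⊞ N ⟶ _ ⊞ X)
        (biprod.fst ≫ β) (by simp [hαβ])).ShortExact :=
      { exact := by
          rw [ShortComplex.exact_iff_exact_up_to_refinements]
          intro A x hx
          obtain ⟨A', ρ, hρ, n, hn⟩ := hex (x ≫ biprod.fst) (by simpa using hx)
          refine ⟨A', ρ, hρ, biprod.lift (ρ ≫ x ≫ biprod.snd) n, ?_⟩
          dsimp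
          ext <;> simp [hn]
        mono_f := by
          refine Preadditive.mono_of_cancel_zero _ fun {A} z hz => ?_
          have h1 := congrArg (· ≫ biprod.fst) hz
          have h2 := congrArg (· ≫ biprod.snd) hz
          dsimp at h1 h2
          ext
          · simpa using h2
          · rw [zero_comp]
            exact hα _ (by simpa using h1)
        epi_g := by dsimp; infer_instance }
    exact gorensteinProjective_of_shortExact.{u, v, w} hT hN hZ
  exists_left := by
    rintro X ⟨N, hN⟩
    have hC := gorensteinProjective_isGorensteinClass.{u, v, w} (C := C)
    obtain ⟨P, K, i, q, w, hS, hP, hK⟩ := hC.exists_left _ hN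
    have hi : Mono i := hS.mono_f
    have hq : Epi q := hS.epi_g
    let ι := kernel.ι (q ≫ biprod.fst)
    have hι : ι ≫ q ≫ biprod.fst = 0 := kernel.condition _
    let k : K ⟶ kernel (q ≫ biprod.fst) := kernel.lift _ i (by rw [← Category.assoc, w, zero_comp])
    have hk : k ≫ ι = i := kernel.lift_ι _ _ _
    have : Mono k := mono_of_mono_fac hk
    refine ⟨P, kernel (q ≫ biprod.fst), ι, q ≫ biprod.fst, kernel.condition _,
      { exact := ShortComplex.exact_kernel _, mono_f := by dsimp; infer_instance,
        epi_g := epi_comp _ _ }, hP, X, ?_⟩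
    have hT : (ShortComplex.mk (biprod.lift k 0 : K ⟶ _ ⊞ X)
        (biprod.lift biprod.snd (biprod.fst ≫ ι ≫ q ≫ biprod.snd) : _ ⟶ X ⊞ N) (by
          ext <;> simp [reassoc_of% hk, reassoc_of% w])).ShortExact :=
      { exact := by
          rw [ShortComplex.exact_iff_exact_up_to_refinements]
          intro A x hx
          have h1 := congrArg (· ≫ biprod.fst) hx
          have h2 := congrArg (· ≫ biprod.snd) hx
          obtain ⟨A', ρ, hρ, y, hy⟩ := hS.exact.exact_up_to_refinements (x ≫ biprod.fst ≫ ι) (by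
            dsimp
            ext
            · simp [hι]
            · simpa using h2)
          refine ⟨A', ρ, hρ, y, ?_⟩
          dsimp at hy h1 ⊢
          refine biprod.hom_ext _ _ ?_ ?_
          · rw [← cancel_mono ι]
            simpa [hk] using hy
          · simpa using congrArg (ρ ≫ ·) h1
        mono_f := mono_of_mono_fac (h := k) (biprod.lift_fst k 0)
        epi_g := by
          rw [epi_iff_surjective_up_to_refinements]
          intro A y
          obtain ⟨A', ρ, hρ, p, hp⟩ :=
            surjective_up_to_refinements_of_epi q (y ≫ biprod.snd ≫ biprod.inr)
          refine ⟨A', ρ, hρ, biprod.lift (kernel.lift _ p (by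
            rw [← Category.assoc, ← hp]; simp)) (ρ ≫ y ≫ biprod.fst), ?_⟩
          dsimp
          ext
          · simp
          · simp [ι, ← reassoc_of% hp] }
    exact gorensteinProjective_of_shortExact.{u, v, w} hT hK hN

/-- Gorenstein projective objects are closed under direct summands. -/
lemma gorensteinProjective_of_biprod [HasExt.{w} C] {X Y : C}
    (h : gorensteinProjective C (X ⊞ Y)) : gorensteinProjective C X :=
  gorensteinSummand_isGorensteinClass.{u, v, w}.gorensteinProjective ⟨Y, h⟩

end GorensteinClass

/-! ### Classes closed under sums and summands -/

section SummandClosed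

variable {C : Type u} [Category.{v} C] [Preadditive C]

/-- A class of objects which contains the zero objects and is closed under binary
direct sums and direct summands. -/
structure IsSummandClosed [HasBinaryBiproducts C] (P : ObjectProperty C) : Prop where
  of_isZero : ∀ X, IsZero X → P X
  biprod : ∀ X Y, P X → P Y → P (X ⊞ Y)
  of_retract : ∀ {X Y} (i : X ⟶ Y) (r : Y ⟶ X), i ≫ r = 𝟙 X → P Y → P X

lemma IsSummandClosed.biproduct [HasFiniteBiproducts C] [HasBinaryBiproducts C]
    {P : ObjectProperty C} (hP : IsSummandClosed P)
    {m : ℕ} (G : Fin m → C) (hG : ∀ i, P (G i)) : P (⨁ G) := by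
  induction m with
  | zero =>
    refine hP.of_isZero _ ?_
    rw [IsZero.iff_id_eq_zero]
    exact biproduct.hom_ext _ _ fun j => j.elim0
  | succ m ih =>
    refine hP.of_retract
      (biprod.lift (biproduct.π G 0) (biproduct.lift fun j : Fin m => biproduct.π G j.succ))
      (biprod.desc (biproduct.ι G 0) (biproduct.desc fun j : Fin m => biproduct.ι G j.succ)) ?_
      (hP.biprod _ _ (hG 0) (ih (fun j => G j.succ) fun j => hG _))
    rw [biprod.lift_desc, biproduct.lift_desc, ← biproduct.total, Fin.sum_univ_succ]

end SummandClosed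

/-! ### Gorenstein projective modules and their generator -/

section Gproj

lemma gorensteinProjective_of_isZero {C : Type u} [Category.{v} C] [Abelian C] [HasExt.{w} C]
    {X : C} (hX : IsZero X) : gorensteinProjective C X := by
  refine IsGorensteinClass.gorensteinProjective.{u, v, w} (P := IsZero)
    { ext_eq_zero := fun X hX Q hQ e => ?_
      exists_right := fun X hX => ⟨X, X, 0, 0, zero_comp, ?_⟩
      exists_left := fun X hX => ⟨X, X, 0, 0, zero_comp, ?_⟩ } hX
  · have : Projective X := Projective.of_iso (hX.iso (isZero_zero C)).symm inferInstance
    exact Abelian.Ext.eq_zero_of_projective e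
  all_goals
    exact ⟨{ exact := ShortComplex.exact_of_isZero_X₂ _ hX
             mono_f := ⟨fun _ _ _ => hX.eq_of_tgt _ _⟩
             epi_g := ⟨fun _ _ _ => hX.eq_of_src _ _⟩ },
      Projective.of_iso (hX.iso (isZero_zero C)).symm inferInstance, hX⟩

variable {A : Type u} [Ring A]

/-- The reverse direction must move the syzygy from an arbitrary degree to degree 0; re-splicing
through `exists_totallyAcyclic` does this without shifting complexes. -/
lemma gproj_iff (G : FGModuleCat.{u} A) :
    gproj A G ↔ gorensteinProjective (ModuleCat.{u} A) G.obj := by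
  constructor
  · rintro ⟨K, hK, e⟩
    refine ⟨K, 0, ⟨fun i => ?_, hK.acyclic, fun Q hQ i j k hij hjk f hf => ?_⟩, e⟩
    · rw [← IsProjective.iff_projective]
      exact hK.projective i
    · obtain rfl : i = j - 1 := by lia
      subst hjk
      exact hK.hom_exact Q ((IsProjective.iff_projective _).2 hQ) j f hf
  · intro h
    obtain ⟨K, hK, e⟩ :=
      gorensteinProjective_isGorensteinClass.{u + 1, u, u}.exists_totallyAcyclic h
    refine ⟨K, ⟨fun i => ?_, hK.acyclic, fun Q hQ i f hf => ?_⟩, e⟩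
    · rw [IsProjective.iff_projective]
      exact hK.projective i
    · exact hK.hom_exact Q ((IsProjective.iff_projective _).1 hQ) _ _ _ (by simp) rfl f hf

variable (A) in
lemma gproj_isSummandClosed : IsSummandClosed (gproj A) where
  of_isZero X hX := (gproj_iff X).2 (gorensteinProjective_of_isZero.{u + 1, u, u}
    ((ModuleCat.isFG A).ι.map_isZero hX))
  biprod X Y hX hY := by
    rw [gproj_iff] at hX hY ⊢
    have := preservesBinaryBiproducts_of_preservesBiproducts (ModuleCat.isFG A).ι
    exact ObjectProperty.prop_of_iso _ ((ModuleCat.isFG A).ι.mapBiprod X Y).symm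
      (gorensteinProjective_biprod.{u + 1, u, u} hX hY)
  of_retract {X Y} i r h hY := by
    rw [gproj_iff] at hY ⊢
    let F := (ModuleCat.isFG A).ι
    have h' : F.map i ≫ F.map r = 𝟙 _ := by rw [← F.map_comp, h, F.map_id]
    have : Mono (F.map i) := mono_of_mono_fac h'
    let e := (ShortComplex.Splitting.ofExactOfRetraction _
      (ShortComplex.exact_cokernel (F.map i)) (F.map r) h' inferInstance).isoBinaryBiproduct
    exact gorensteinProjective_of_biprod.{u + 1, u, u} (ObjectProperty.prop_of_iso _ e hY)

lemma length_of_iso_biprod {X Y Z : FGModuleCat.{u} A} (e : X ≅ Y ⊞ Z) :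
    Module.length A X = Module.length A Y + Module.length A Z := by
  have h {U V W : FGModuleCat.{u} A} {f : U ⟶ V} {g : V ⟶ W} {k : U ⟶ W} (hk : f ≫ g = k)
      (x : U) : g.hom.hom (f.hom.hom x) = k.hom.hom x := by rw [← hk]; rfl
  refine Module.length_eq_add_of_exact (biprod.inl ≫ e.inv).hom.hom (e.hom ≫ biprod.snd).hom.hom
    (Function.LeftInverse.injective (g := (e.hom ≫ biprod.fst).hom.hom)
      fun x => h (k := 𝟙 _) (by simp) x)
    (Function.RightInverse.surjective (g := (biprod.inr ≫ e.inv).hom.hom)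
      fun x => h (k := 𝟙 _) (by simp) x) fun x => ⟨fun hx => ?_, ?_⟩
  · refine ⟨(e.hom ≫ biprod.fst).hom.hom x, ?_⟩
    rw [h (k := 𝟙 X - (e.hom ≫ biprod.snd) ≫ biprod.inr ≫ e.inv)]
    · have := h (f := e.hom ≫ biprod.snd) (g := biprod.inr ≫ e.inv) rfl x
      rw [hx, map_zero] at this
      exact (congrArg (x - ·) this.symm).trans (sub_zero x)
    · rw [eq_sub_iff_add_eq, ← cancel_epi e.inv, ← cancel_mono e.hom]
      simp [Preadditive.comp_add, Preadditive.add_comp]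
  · rintro ⟨y, rfl⟩
    rw [h (k := 0) (by simp)]
    rfl

lemma isZero_of_subsingleton (X : FGModuleCat.{u} A) [Subsingleton X] : IsZero X := by
  rw [IsZero.iff_id_eq_zero]
  ext x
  exact Subsingleton.elim _ _

/-- A summand closed class containing the Gorenstein projective generator contains all
Gorenstein projective modules. -/
lemma prop_of_gproj [IsNoetherianRing A] [IsArtinianRing A] {GA : FGModuleCat.{u} A}
    (hGA : IsGprojGenerator A GA) {P : ObjectProperty (FGModuleCat.{u} A)}
    (hP : IsSummandClosed P) (h : P GA) {X : FGModuleCat.{u} A} (hX : gproj A X) : P X := by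
  obtain ⟨m, G, hG, ⟨e⟩⟩ := hGA
  -- Induction on the length: either the module is indecomposable, hence a summand of the generator,
  -- or it splits into two shorter summands, which are again Gorenstein projective.
  obtain ⟨k, hk⟩ := ENat.ne_top_iff_exists.1 (Module.length_ne_top_iff.2
    (isFiniteLength_iff_isNoetherian_isArtinian.2
      ⟨(inferInstance : IsNoetherian A X), (inferInstance : IsArtinian A X)⟩))
  induction k using Nat.strong_induction_on generalizing X with
  | _ k ih =>
  by_cases h0 : IsZero X
  · exact hP.of_isZero X h0
  by_cases hind : Indecomposable X
  · obtain ⟨i, ⟨f⟩⟩ := hG.complete X hind hX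
    exact hP.of_retract (f.hom ≫ biproduct.ι G i ≫ e.inv) (e.hom ≫ biproduct.π G i ≫ f.inv)
      (by simp) h
  have hne : ∃ (Y Z : FGModuleCat.{u} A) (_ : X ≅ Y ⊞ Z), ¬ IsZero Y ∧ ¬ IsZero Z := by
    by_contra! hc
    refine hind ⟨h0, fun Y Z f => ?_⟩
    by_cases hY : IsZero Y
    · exact Or.inl hY
    · exact Or.inr (hc Y Z f hY)
  obtain ⟨Y, Z, f, hY, hZ⟩ := hne
  have hS := gproj_isSummandClosed A
  have hfin (W : FGModuleCat.{u} A) : ∃ k : ℕ, (k : ℕ∞) = Module.length A W :=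
    ENat.ne_top_iff_exists.1 (Module.length_ne_top_iff.2
      (isFiniteLength_iff_isNoetherian_isArtinian.2
        ⟨(inferInstance : IsNoetherian A W), (inferInstance : IsArtinian A W)⟩))
  obtain ⟨a, ha⟩ := hfin Y
  obtain ⟨b, hb⟩ := hfin Z
  have hlen := length_of_iso_biprod f
  rw [← ha, ← hb, ← hk] at hlen
  norm_cast at hlen
  have hpos {W : FGModuleCat.{u} A} (hW : ¬ IsZero W) {c : ℕ} (hc : (c : ℕ∞) = Module.length A W) :
      c ≠ 0 := by
    rintro rfl
    have : Subsingleton W := Module.length_eq_zero_iff.1 hc.symm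
    exact hW (isZero_of_subsingleton W)
  have ha0 := hpos hY ha
  have hb0 := hpos hZ hb
  refine hP.of_retract f.hom f.inv f.hom_inv_id (hP.biprod _ _
    (ih a (by lia) (hS.of_retract (biprod.inl ≫ f.inv) (f.hom ≫ biprod.fst) (by simp) hX) ha)
    (ih b (by lia) (hS.of_retract (biprod.inr ≫ f.inv) (f.hom ≫ biprod.snd) (by simp) hX) hb))

lemma gproj_of_isGprojGenerator {GA : FGModuleCat.{u} A} (hGA : IsGprojGenerator A GA) :
    gproj A GA := by
  obtain ⟨m, G, hG, ⟨e⟩⟩ := hGA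
  exact (gproj_isSummandClosed A).of_retract e.hom e.inv e.hom_inv_id
    ((gproj_isSummandClosed A).biproduct G hG.gproj)

end Gproj

/-! ### Chain conditions on Hom modules -/

section ChainConditions

lemma isNoetherian_isArtinian_of_orderEmbedding {R : Type*} {S : Type*} [Ring R] [Ring S]
    {M : Type*} {N : Type*} [AddCommGroup M] [AddCommGroup N] [Module R M] [Module S N]
    (φ : Submodule S N ↪o Submodule R M) (h : IsNoetherian R M ∧ IsArtinian R M) :
    IsNoetherian S N ∧ IsArtinian S N :=
  ⟨isNoetherian_mk ⟨φ.dual.wellFounded h.1.wf⟩, ⟨φ.wellFounded h.2.wf⟩⟩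

/-- The chain conditions pass to a quotient which is only semilinear. -/
lemma isNoetherian_isArtinian_of_surjective {R : Type*} {S : Type*} [Ring R] [Ring S]
    {M : Type*} {N : Type*} [AddCommGroup M] [AddCommGroup N] [Module R M] [Module S N]
    {σ : R →+* S} (f : M →ₛₗ[σ] N) (hf : Function.Surjective f)
    (h : IsNoetherian R M ∧ IsArtinian R M) : IsNoetherian S N ∧ IsArtinian S N :=
  isNoetherian_isArtinian_of_orderEmbedding (OrderEmbedding.ofMapLEIff (Submodule.comap f)
    fun p q => ⟨fun hpq x hx => by
      obtain ⟨y, rfl⟩ := hf x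
      exact hpq hx, fun hpq x hx => hpq hx⟩) h

variable (k : Type w) [CommRing k] [IsArtinianRing k] {A : Type u} [Ring A] [Algebra k A]
  [Module.Finite k A]

-- Evaluation at generators of `G` embeds the lattice of End(G)-submodules into that of k-submodules
-- of X^n. These are k-submodules because scalars of k act through homotheties of `G`.
include k in
lemma isNoetherian_isArtinian_hom (G X : FGModuleCat.{u} A) :
    IsNoetherian (End G)ᵐᵒᵖ (G ⟶ X) ∧ IsArtinian (End G)ᵐᵒᵖ (G ⟶ X) := by
  let _ : Module k X := Module.compHom X (algebraMap k A)
  have : IsScalarTower k A X := ⟨fun c a x => by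
    rw [Algebra.smul_def, mul_smul]
    rfl⟩
  have : Module.Finite k X := Module.Finite.trans A X
  obtain ⟨n, s, hs⟩ := Module.Finite.exists_fin (R := A) (M := G)
  let homothety (c : k) : End G := FGModuleCat.ofHom
    { toFun := fun x => algebraMap k A c • x
      map_add' := fun x y => smul_add _ _ _
      map_smul' := fun a x => by
        rw [← mul_smul, Algebra.commutes, mul_smul]
        rfl }
  let φ (N : Submodule (End G)ᵐᵒᵖ (G ⟶ X)) : Submodule k (Fin n → X) :=
    { carrier := {v | ∃ f ∈ N, ∀ i, f.hom.hom (s i) = v i}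
      add_mem' := by
        rintro v w ⟨f, hf, hv⟩ ⟨g, hg, hw⟩
        refine ⟨f + g, N.add_mem hf hg, fun i => ?_⟩
        rw [Pi.add_apply, ← hv, ← hw]
        rfl
      zero_mem' := ⟨0, N.zero_mem, fun i => rfl⟩
      smul_mem' := by
        rintro c v ⟨f, hf, hv⟩
        refine ⟨MulOpposite.op (homothety c) • f, N.smul_mem _ hf, fun i => ?_⟩
        rw [Pi.smul_apply, ← hv]
        exact f.hom.hom.map_smul (algebraMap k A c) (s i) }
  refine isNoetherian_isArtinian_of_orderEmbedding (R := k) (M := Fin n → X)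
    (OrderEmbedding.ofMapLEIff φ fun N N' => ⟨fun h f hf => ?_, fun h v hv => ?_⟩)
    ⟨inferInstance, inferInstance⟩
  · obtain ⟨g, hg, hgf⟩ := h (show (fun i => f.hom.hom (s i)) ∈ φ N from ⟨f, hf, fun i => rfl⟩)
    have : g = f := by
      ext x
      exact LinearMap.congr_fun (LinearMap.ext_on_range hs hgf) x
    rwa [← this]
  · obtain ⟨f, hf, hfv⟩ := hv
    exact ⟨f, h hf, hfv⟩

end ChainConditions

/-! ### Exactness of Hom(G, K) and homotopies -/

section Complexes

variable {C : Type u} [Category.{v} C] [Preadditive C]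

/-- `Hom(G, K)` is exact in degree `j`. -/
def HomExactAt (G : C) (K : CochainComplex C ℤ) (j : ℤ) : Prop :=
  ∀ i k : ℤ, i + 1 = j → j + 1 = k → ∀ g : G ⟶ K.X j, g ≫ K.d j k = 0 →
    ∃ s : G ⟶ K.X i, s ≫ K.d i j = g

lemma homExactAt_iff_of_eq {G : C} {K : CochainComplex C ℤ} {i j k : ℤ} (hij : i + 1 = j)
    (hjk : j + 1 = k) : HomExactAt G K j ↔ ∀ g : G ⟶ K.X j, g ≫ K.d j k = 0 →
      ∃ s : G ⟶ K.X i, s ≫ K.d i j = g := by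
  refine ⟨fun h => h i k hij hjk, fun h i' k' hi hk => ?_⟩
  obtain rfl : i = i' := by lia
  obtain rfl : k = k' := by lia
  exact h

lemma homExactAt_of_isZero {G : C} {K : CochainComplex C ℤ} {j : ℤ} (h : IsZero (K.X j)) :
    HomExactAt G K j := fun _ _ _ _ _ _ => ⟨0, h.eq_of_tgt _ _⟩

lemma homExactAt_isSummandClosed [HasBinaryBiproducts C] (K : CochainComplex C ℤ) (j : ℤ) :
    IsSummandClosed (fun G => HomExactAt G K j) where
  of_isZero X hX i k hi hk g hg := ⟨0, hX.eq_of_src _ _⟩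
  biprod X Y hX hY i k hi hk g hg := by
    obtain ⟨s, hs⟩ := hX i k hi hk (biprod.inl ≫ g) (by simp [hg])
    obtain ⟨t, ht⟩ := hY i k hi hk (biprod.inr ≫ g) (by simp [hg])
    exact ⟨biprod.desc s t, biprod.hom_ext' _ _ (by simp [hs]) (by simp [ht])⟩
  of_retract a r h hY i k hi hk g hg := by
    obtain ⟨s, hs⟩ := hY i k hi hk (r ≫ g) (by simp [hg])
    exact ⟨a ≫ s, by simp [hs, reassoc_of% h]⟩

lemma exact_units_smul_iff {G X Y Z : C} (ε : ℤˣ) (f : X ⟶ Y) (g : Y ⟶ Z) :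
    (∀ x : G ⟶ Y, x ≫ (ε • g) = 0 → ∃ s : G ⟶ X, s ≫ (ε • f) = x) ↔
      ∀ x : G ⟶ Y, x ≫ g = 0 → ∃ s : G ⟶ X, s ≫ f = x := by
  obtain rfl | rfl := Int.units_eq_one_or ε
  · simp
  · simp only [Units.neg_smul, one_smul, Preadditive.comp_neg, neg_eq_zero]
    exact forall₂_congr fun x _ => ⟨fun ⟨s, hs⟩ => ⟨-s, by simpa using hs⟩,
      fun ⟨s, hs⟩ => ⟨-s, by simpa using hs⟩⟩

lemma homExactAt_shift_iff {G : C} {K : CochainComplex C ℤ} {n j m : ℤ} (h : j + n = m) :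
    HomExactAt G (K⟦n⟧) j ↔ HomExactAt G K m := by
  subst h
  rw [homExactAt_iff_of_eq (i := j - 1) (k := j + 1) (by simp) rfl,
    homExactAt_iff_of_eq (i := j - 1 + n) (k := j + 1 + n) (by lia) (by lia)]
  exact exact_units_smul_iff n.negOnePow (K.d (j - 1 + n) (j + n)) (K.d (j + n) (j + 1 + n))

/-- A chain map from a complex bounded below to a complex which is exact with respect to its
terms is null-homotopic as soon as it vanishes in large degrees. -/
lemma quotient_map_eq_zero_of_homExactAt {P K : CochainComplex C ℤ} {a : ℤ} [P.IsStrictlyGE a]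
    (h : ∀ i, HomExactAt (P.X i) K i) (k : ℕ) (f : P ⟶ K) (hf : ∀ i, a + k ≤ i → f.f i = 0) :
    (HomotopyCategory.quotient C (ComplexShape.up ℤ)).map f = 0 := by
  induction k generalizing f with
  | zero =>
    have : f = 0 := by
      ext i
      by_cases hi : a ≤ i
      · exact hf i (by simpa using hi)
      · exact (P.isZero_of_isStrictlyGE a i (by lia)).eq_of_src _ _
    rw [this, Functor.map_zero]
  | succ k ih =>
    obtain ⟨j, hj⟩ : ∃ j : ℤ, j = a + k := ⟨_, rfl⟩
    obtain ⟨s, hs⟩ := h j (j - 1) (j + 1) (by simp) rfl (f.f j) (by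
      rw [f.comm, hf (j + 1) (by push_cast; lia), comp_zero])
    -- A homotopy with the single component `s` out of degree j. The null-homotopic map it defines
    -- agrees with `f` in degree j and vanishes above, so subtracting it pushes `f` one degree down.
    let η (i i' : ℤ) (r : (ComplexShape.up ℤ).Rel i' i) : P.X i ⟶ K.X i' :=
      if hi : i = j then (P.XIsoOfEq hi).hom ≫ s ≫
        (K.XIsoOfEq (show j - 1 = i' by simp at r; lia)).hom else 0
    have hη {i i'} (r) (hi : i ≠ j) : η i i' r = 0 := dif_neg hi
    have hηj : η j (j - 1) (by simp) = s := by simp [η]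
    let N := Homotopy.nullHomotopicMap' η
    have hN (i : ℤ) : N.f i = P.d i (i + 1) ≫ η (i + 1) i (by simp) +
        η i (i - 1) (by simp) ≫ K.d (i - 1) i :=
      Homotopy.nullHomotopicMap'_f (by simp) (by simp) η
    have hN0 : (HomotopyCategory.quotient C (ComplexShape.up ℤ)).map N = 0 := by
      rw [← Functor.map_zero]
      exact HomotopyCategory.eq_of_homotopy _ _ (Homotopy.nullHomotopy' η)
    have := ih (f - N) fun i hi => by
      rw [HomologicalComplex.sub_f_apply, hN, hη (by simp) (by lia), comp_zero, zero_add, sub_eq_zero]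
      obtain rfl | hi' := hi.eq_or_lt
      · rw [← hj, hηj, hs]
      · rw [hη (by simp) (by lia), zero_comp]
        exact hf i (by push_cast; lia)
    rwa [Functor.map_sub, hN0, sub_zero] at this

lemma quotient_map_eq_zero {P K : CochainComplex C ℤ} (hP : IsBounded C P)
    (h : ∀ i, HomExactAt (P.X i) K i) (f : P ⟶ K) :
    (HomotopyCategory.quotient C (ComplexShape.up ℤ)).map f = 0 := by
  obtain ⟨a, b, _, _⟩ := hP
  refine quotient_map_eq_zero_of_homExactAt (a := a) h (b - a + 1).natAbs f fun i hi => ?_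
  exact (P.isZero_of_isStrictlyLE b i (by lia)).eq_of_src _ _

section Single

variable [HasZeroObject C]

/-- The term in degree `j` of a stalk complex in degree `j`. -/
noncomputable def singleXSelf (G : C) (j : ℤ) :
    ((CochainComplex.singleFunctor C j).obj G).X j ≅ G :=
  HomologicalComplex.singleObjXSelf (ComplexShape.up ℤ) j G

/-- The chain map from a stalk complex given by a cocycle. -/
noncomputable def homOfCocycle {G : C} {K : CochainComplex C ℤ} {j : ℤ} (g : G ⟶ K.X j)
    (hg : g ≫ K.d j (j + 1) = 0) : (CochainComplex.singleFunctor C j).obj G ⟶ K :=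
  HomologicalComplex.mkHomFromSingle g fun k hk => by
    obtain rfl : j + 1 = k := hk
    exact hg

lemma homOfCocycle_f {G : C} {K : CochainComplex C ℤ} {j : ℤ} (g : G ⟶ K.X j)
    (hg : g ≫ K.d j (j + 1) = 0) : (homOfCocycle g hg).f j = (singleXSelf G j).hom ≫ g :=
  HomologicalComplex.mkHomFromSingle_f _ _

lemma homExactAt_single {G M : C} {i j : ℤ} (h : j ≠ i) :
    HomExactAt G ((CochainComplex.singleFunctor C i).obj M) j :=
  homExactAt_of_isZero (HomologicalComplex.isZero_single_obj_X _ _ _ _ h)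

/-- `Hom(G, -)` in the homotopy category computes the cohomology of `Hom(G, K)`. -/
lemma homExactAt_zero_iff {G : C} {K : CochainComplex C ℤ} :
    HomExactAt G K 0 ↔
      ∀ f : (HomotopyCategory.quotient C (ComplexShape.up ℤ)).obj
          ((CochainComplex.singleFunctor C 0).obj G) ⟶
        (HomotopyCategory.quotient C (ComplexShape.up ℤ)).obj K, f = 0 := by
  constructor
  · intro h f
    obtain ⟨f, rfl⟩ := (HomotopyCategory.quotient _ _).map_surjective f
    refine quotient_map_eq_zero ⟨0, 0, inferInstance, inferInstance⟩ (fun i => ?_) f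
    by_cases hi : i = 0
    · subst hi
      intro i k hi hk g hg
      obtain ⟨s, hs⟩ := h i k hi hk ((singleXSelf G 0).inv ≫ g) (by
        simp [hg])
      exact ⟨(singleXSelf G 0).hom ≫ s, by simp [hs]⟩
    · exact fun _ _ _ _ _ _ => ⟨0, (HomologicalComplex.isZero_single_obj_X _ _ _ _ hi).eq_of_src _ _⟩
  · intro h
    rw [homExactAt_iff_of_eq (i := -1) (k := 1) (by simp) (by simp)]
    intro g hg
    have h0 := h ((HomotopyCategory.quotient _ _).map (homOfCocycle g hg))
    rw [← Functor.map_zero] at h0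
    have H := HomotopyCategory.homotopyOfEq _ _ h0
    have := H.comm 0
    rw [dNext_eq _ (show (ComplexShape.up ℤ).Rel 0 1 by simp),
      prevD_eq _ (show (ComplexShape.up ℤ).Rel (-1) 0 by simp)] at this
    refine ⟨(singleXSelf G 0).inv ≫ H.hom 0 (-1), ?_⟩
    rw [Category.assoc]
    have h2 : ((CochainComplex.singleFunctor C 0).obj G).d 0 1 = 0 := rfl
    rw [homOfCocycle_f, h2, zero_comp, zero_add, HomologicalComplex.zero_f_apply, add_zero] at this
    rw [← this, Iso.inv_hom_id_assoc]

end Single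

end Complexes

/-! ### Truncations seen by Hom(G, -) -/

section Truncation

variable {C : Type u} [Category.{v} C] [Abelian C]

lemma mono_ιTruncLE_f (K : CochainComplex C ℤ) (n i : ℤ) : Mono ((K.ιTruncLE n).f i) :=
  inferInstanceAs
    (Mono ((HomologicalComplex.ιTruncLE K (ComplexShape.embeddingUpIntLE n)).f i))

lemma isIso_ιTruncLE_f (K : CochainComplex C ℤ) {n i : ℤ} (hi : i < n) :
    IsIso ((K.ιTruncLE n).f i) := by
  let e := ComplexShape.embeddingUpIntLE n
  have h1 : e.f (n - i).natAbs = i := by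
    change n - ((n - i).natAbs : ℤ) = i
    lia
  have h2 : ¬ e.op.BoundaryGE (n - i).natAbs := by
    rw [ComplexShape.Embedding.op_boundaryGE_iff, ComplexShape.boundaryLE_embeddingUpIntLE_iff]
    lia
  have : IsIso ((HomologicalComplex.πTruncGE (HomologicalComplex.op K) e.op).f i) := by
    refine (e.op.isIso_liftExtend_f_iff _ _ h1).mpr ?_
    exact HomologicalComplex.isIso_restrictionToTruncGE' _ _ _ h2
  exact inferInstanceAs
    (IsIso ((HomologicalComplex.πTruncGE (HomologicalComplex.op K) e.op).f i).unop)

/-- Below degree n the truncation map is an isomorphism. In degree n the hypothesis says that `k` is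
a cocycle, i.e. a map from a stalk complex in degree n, and such a complex is unchanged by
truncation. -/
lemma exists_lift_truncLE {G : C} {K : CochainComplex C ℤ} {n i j : ℤ} (hij : i + 1 = j)
    (hi : i ≤ n) (k : G ⟶ K.X i) (t : G ⟶ (K.truncLE n).X j)
    (h : k ≫ K.d i j = t ≫ (K.ιTruncLE n).f j) :
    ∃ l : G ⟶ (K.truncLE n).X i, l ≫ (K.ιTruncLE n).f i = k := by
  obtain hi | rfl := hi.lt_or_eq
  · have := isIso_ιTruncLE_f K hi
    exact ⟨k ≫ inv ((K.ιTruncLE n).f i), by rw [Category.assoc, IsIso.inv_hom_id, Category.comp_id]⟩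
  · subst hij
    have h0 : k ≫ K.d i (i + 1) = 0 := by
      rw [h, ((K.truncLE i).isZero_of_isStrictlyLE i (i + 1) (by simp)).eq_of_tgt t 0, zero_comp]
    let f := homOfCocycle k h0
    obtain ⟨ψ, hψ⟩ : ∃ ψ : (CochainComplex.singleFunctor C i).obj G ⟶ K.truncLE i,
        ψ ≫ K.ιTruncLE i = f := by
      refine ⟨inv (CochainComplex.ιTruncLE ((CochainComplex.singleFunctor C i).obj G) i) ≫
        HomologicalComplex.truncLEMap f (ComplexShape.embeddingUpIntLE i), ?_⟩
      rw [Category.assoc, IsIso.inv_comp_eq]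
      exact CochainComplex.ιTruncLE_naturality f i
    have hfi := HomologicalComplex.congr_hom hψ i
    rw [homOfCocycle_f, ← Iso.inv_comp_eq] at hfi
    exact ⟨(singleXSelf G i).inv ≫ ψ.f i, (Category.assoc _ _ _).trans hfi⟩

lemma homExactAt_truncLE {G : C} {K : CochainComplex C ℤ} {n : ℤ}
    (h : ∀ i ≤ n, HomExactAt G K i) (i : ℤ) : HomExactAt G (K.truncLE n) i := by
  have := mono_ιTruncLE_f K n i
  by_cases hi : i ≤ n
  · intro j k hj hk g hg
    obtain ⟨s, hs⟩ := h i hi j k hj hk (g ≫ (K.ιTruncLE n).f i) (by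
      rw [Category.assoc, HomologicalComplex.Hom.comm, reassoc_of% hg, zero_comp])
    obtain ⟨l, hl⟩ := exists_lift_truncLE hj (by lia) s g hs
    refine ⟨l, ?_⟩
    rw [← cancel_mono ((K.ιTruncLE n).f i), Category.assoc, ← HomologicalComplex.Hom.comm,
      reassoc_of% hl, hs]
  · exact homExactAt_of_isZero ((K.truncLE n).isZero_of_isStrictlyLE n i (by lia))

open CochainComplex in
lemma homExactAt_mappingCone_ιTruncLE {G : C} {K : CochainComplex C ℤ} {n i : ℤ} (hi : i ≤ n) :
    HomExactAt G (mappingCone (K.ιTruncLE n)) i := by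
  let φ := K.ιTruncLE n
  rw [homExactAt_iff_of_eq (i := i - 1) (k := i + 1) (by simp) rfl]
  intro g hg
  let t := g ≫ (mappingCone.fst φ).1.v i (i + 1) rfl
  let k := g ≫ (mappingCone.snd φ).v i i (add_zero i)
  have hk : k ≫ K.d i (i + 1) = (-t) ≫ φ.f (i + 1) := by
    have := hg =≫ (mappingCone.snd φ).v (i + 1) (i + 1) (add_zero _)
    rw [Category.assoc, mappingCone.d_snd_v φ i (i + 1) rfl, zero_comp, Preadditive.comp_add] at this
    rw [Preadditive.neg_comp]
    simp only [t, k, Category.assoc]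
    exact eq_neg_of_add_eq_zero_right this
  have := mono_ιTruncLE_f K n (i + 1)
  obtain ⟨l, hl⟩ := exists_lift_truncLE rfl hi k (-t) hk
  have hlt : l ≫ (K.truncLE n).d i (i + 1) = -t := by
    rw [← cancel_mono (φ.f (i + 1)), ← hk, ← hl, Category.assoc, Category.assoc, φ.comm]
  refine ⟨l ≫ (mappingCone.inl φ).v i (i - 1) (by lia), ?_⟩
  rw [Category.assoc, mappingCone.inl_v_d φ i (i - 1) (i + 1) (by lia) (by simp),
    Preadditive.comp_sub, reassoc_of% hlt, reassoc_of% hl, Preadditive.neg_comp, sub_neg_eq_add,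
    add_comm]
  simp only [t, k, Category.assoc]
  rw [← Preadditive.comp_add, mappingCone.id_X]
  exact Category.comp_id _

end Truncation

lemma extVanish_map_iff {T : Type u} [Category.{v} T] [Preadditive T] [HasShift T ℤ]
    {T' : Type w} [Category.{w'} T'] [Preadditive T'] [HasShift T' ℤ]
    (F : T ⥤ T') [F.CommShift ℤ] [F.PreservesZeroMorphisms] {S : T}
    (h : ∀ Y, Function.Bijective (F.map : (S ⟶ Y) → (F.obj S ⟶ F.obj Y))) {X : T} {i : ℤ} :
    ExtVanish (F.obj S) (F.obj X) i ↔ ExtVanish S X i := by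
  refine ⟨fun H f => (h _).1 ?_, fun H f => ?_⟩
  · rw [Functor.map_zero, ← cancel_mono ((F.commShiftIso i).hom.app X), zero_comp]
    exact H _
  · rw [← cancel_mono ((F.commShiftIso i).inv.app X), zero_comp]
    obtain ⟨g, hg⟩ := (h _).2 (f ≫ (F.commShiftIso i).inv.app X)
    rw [← hg, H g, Functor.map_zero]

/-! ### Gorenstein acyclicity and Hom out of stalk complexes -/

section

variable {A : Type u} [Ring A]

lemma gAcyclicKb_iff {K : CochainComplex (FGModuleCat.{u} A) ℤ} (hK : IsBounded _ K) :
    gAcyclicKb A ⟨(HomotopyCategory.quotient _ _).obj K, hK⟩ ↔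
      ∀ G, gproj A G → ∀ i, HomExactAt G K i := by
  refine (gAcyclic_quotient_obj_iff A K).trans
    (forall₂_congr fun G _ => forall_congr' fun i => ?_)
  rw [HomologicalComplex.exactAt_iff' _ (i - 1) i (i + 1) (by simp) (by simp),
    ShortComplex.ab_exact_iff, homExactAt_iff_of_eq (i := i - 1) (k := i + 1) (by simp) rfl]
  rfl

lemma gAcyclicKb_of_generator [IsNoetherianRing A] [IsArtinianRing A] {GA : FGModuleCat.{u} A}
    (hGA : IsGprojGenerator A GA) {K : CochainComplex (FGModuleCat.{u} A) ℤ} (hK : IsBounded _ K)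
    (h : ∀ i, HomExactAt GA K i) : gAcyclicKb A ⟨(HomotopyCategory.quotient _ _).obj K, hK⟩ :=
  (gAcyclicKb_iff hK).2 fun _ hG i => prop_of_gproj hGA (homExactAt_isSummandClosed K i) (h i) hG

lemma leftOrthogonal_of_gproj {P : CochainComplex (FGModuleCat.{u} A) ℤ} (hP : IsBounded _ P)
    (h : ∀ i, gproj A (P.X i)) :
    (gAcyclicKb A).leftOrthogonal ⟨(HomotopyCategory.quotient _ _).obj P, hP⟩ := by
  intro Y f hY
  refine (bounded _).ι.map_injective ?_
  rw [Functor.map_zero]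
  obtain ⟨f', hf'⟩ := (HomotopyCategory.quotient _ (ComplexShape.up ℤ)).map_surjective
    (X := P) (Y := Y.obj.as) ((bounded _).ι.map f)
  rw [← hf']
  exact quotient_map_eq_zero hP (fun i => (gAcyclicKb_iff Y.property).1 hY _ (h i) i) f'

lemma gproj_of_isZero {X : FGModuleCat.{u} A} (hX : IsZero X) : gproj A X :=
  (gproj_isSummandClosed A).of_isZero _ hX

lemma gproj_single {G : FGModuleCat.{u} A} (hG : gproj A G) (i j : ℤ) :
    gproj A (((CochainComplex.singleFunctor _ i).obj G).X j) := by
  by_cases h : j = i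
  · subst h
    exact (gproj_isSummandClosed A).of_retract (singleXSelf G j).hom _ (Iso.hom_inv_id _) hG
  · exact gproj_of_isZero (HomologicalComplex.isZero_single_obj_X _ _ _ _ h)

/-- A Gorenstein projective stalk complex is left orthogonal to the acyclic complexes, so the
localization does not change maps out of it, and in the homotopy category these compute the
cohomology of Hom(G, K). -/
lemma extVanish_stalk_iff {G : FGModuleCat.{u} A} (hG : gproj A G)
    {K : CochainComplex (FGModuleCat.{u} A) ℤ} (hK : IsBounded _ K) {i : ℤ} :
    ExtVanish (stalk A G) (toDbGp A K hK) i ↔ HomExactAt G K i := by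
  refine (extVanish_map_iff (gAcyclicKb A).trW.Q fun Y =>
    (leftOrthogonal_of_gproj _ (gproj_single hG 0)).map_bijective_of_isTriangulated _ Y).trans
    ((extVanish_map_iff (bounded _).ι
      fun Y => ⟨(bounded _).ι.map_injective, (bounded _).ι.map_surjective⟩).symm.trans ?_)
  rw [← homExactAt_shift_iff (zero_add i), homExactAt_zero_iff,
    ← HomotopyCategory.shift_quotient_obj]
  rfl

lemma exists_iso_toDbGp (X : DbGp A) : ∃ (K : CochainComplex (FGModuleCat.{u} A) ℤ)
    (hK : IsBounded _ K), Nonempty (toDbGp A K hK ≅ X) := by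
  have := Localization.essSurj (gAcyclicKb A).trW.Q (gAcyclicKb A).trW
  exact ⟨_, ((gAcyclicKb A).trW.Q.objPreimage X).property,
    ⟨(gAcyclicKb A).trW.Q.objObjPreimageIso X⟩⟩

end

/-! ### Chain maps and cones in the bounded homotopy category -/

section

variable {C : Type u} [Category.{v} C] [Preadditive C]

lemma isZero_mappingCone_X [HasBinaryBiproducts C] {K L : CochainComplex C ℤ} (φ : K ⟶ L) {i j : ℤ} (hij : i + 1 = j)
    (hK : IsZero (K.X j)) (hL : IsZero (L.X i)) : IsZero ((CochainComplex.mappingCone φ).X i) := by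
  subst hij
  exact (CochainComplex.mappingCone.isZero_X_iff φ i).2 ⟨hK, hL⟩

lemma isBounded_mappingCone [HasBinaryBiproducts C] {K L : CochainComplex C ℤ} (φ : K ⟶ L) (hK : IsBounded C K)
    (hL : IsBounded C L) : IsBounded C (CochainComplex.mappingCone φ) := by
  obtain ⟨a₁, b₁, _, _⟩ := hK
  obtain ⟨a₂, b₂, _, _⟩ := hL
  refine ⟨min (a₁ - 1) a₂, max b₁ b₂,
    CochainComplex.isStrictlyGE_mappingCone φ a₁ a₂ _ (by simp) (by simp), ?_⟩
  rw [CochainComplex.isStrictlyLE_iff]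
  exact fun i hi => isZero_mappingCone_X φ rfl
    (CochainComplex.isZero_of_isStrictlyLE K b₁ _ (by lia))
    (CochainComplex.isZero_of_isStrictlyLE L b₂ _ (by lia))

/-- A bounded complex as an object of the bounded homotopy category. -/
def toKb (K : CochainComplex C ℤ) (hK : IsBounded C K) : Kb C :=
  ⟨(HomotopyCategory.quotient _ _).obj K, hK⟩

/-- The morphism of `Kᵇ(C)` given by a chain map. -/
def toKbMap {K L : CochainComplex C ℤ} (hK : IsBounded C K) (hL : IsBounded C L) (f : K ⟶ L) :
    toKb K hK ⟶ toKb L hL :=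
  ObjectProperty.homMk ((HomotopyCategory.quotient C (ComplexShape.up ℤ)).map f)

section

variable {K L M : CochainComplex C ℤ} (hK : IsBounded C K) (hL : IsBounded C L)
  (hM : IsBounded C M)

lemma toKbMap_comp (f : K ⟶ L) (g : L ⟶ M) :
    toKbMap hK hM (f ≫ g) = toKbMap hK hL f ≫ toKbMap hL hM g :=
  (bounded C).ι.map_injective ((HomotopyCategory.quotient C (ComplexShape.up ℤ)).map_comp f g)

lemma toKbMap_id : toKbMap hK hK (𝟙 K) = 𝟙 _ :=
  (bounded C).ι.map_injective ((HomotopyCategory.quotient C (ComplexShape.up ℤ)).map_id K)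

lemma toKbMap_add (f g : K ⟶ L) :
    toKbMap hK hL (f + g) = toKbMap hK hL f + toKbMap hK hL g :=
  (bounded C).ι.map_injective (HomotopyCategory.quotient C (ComplexShape.up ℤ)).map_add

lemma toKbMap_surjective (f : toKb K hK ⟶ toKb L hL) : ∃ φ, toKbMap hK hL φ = f := by
  obtain ⟨φ, hφ⟩ := (HomotopyCategory.quotient C (ComplexShape.up ℤ)).map_surjective
    (X := K) (Y := L) ((bounded C).ι.map f)
  exact ⟨φ, (bounded C).ι.map_injective hφ⟩

end

lemma toKb_distinguished [HasZeroObject C] [HasBinaryBiproducts C] {K L : CochainComplex C ℤ} (φ : K ⟶ L) (hK : IsBounded C K)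
    (hL : IsBounded C L) :
    ∃ h, Triangle.mk (toKbMap hK hL φ) (toKbMap hL (isBounded_mappingCone φ hK hL)
        (CochainComplex.mappingCone.inr φ)) h ∈ distTriang (Kb C) := by
  refine ⟨(bounded C).fullyFaithfulι.preimage ((CochainComplex.mappingCone.triangleh φ).mor₃ ≫
    ((bounded C).ι.commShiftIso (1 : ℤ)).inv.app (toKb K hK)), ?_⟩
  refine isomorphic_distinguished _ (HomotopyCategory.mappingCone_triangleh_distinguished φ) _ ?_
  refine Triangle.isoMk _ _ (Iso.refl _) (Iso.refl _) (Iso.refl _) ?_ ?_ ?_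
  · exact (Category.comp_id _).trans (Category.id_comp _).symm
  · exact (Category.comp_id _).trans (Category.id_comp _).symm
  · refine (congrArg (_ ≫ ·) (CategoryTheory.Functor.map_id _ _)).trans ((Category.comp_id _).trans
      (Eq.trans ?_ (Category.id_comp _).symm))
    exact (Category.assoc _ _ _).trans ((congrArg _ (Iso.inv_hom_id_app _ _)).trans
      (Category.comp_id _))

end

/-! ### Chain maps and cones in the Gorenstein derived category -/

section

variable {A : Type u} [Ring A]

/-- The morphism of `Dᵇ_gp(A-mod)` given by a chain map. -/
noncomputable def toDbGpMap {K L : CochainComplex (FGModuleCat.{u} A) ℤ} (hK : IsBounded _ K)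
    (hL : IsBounded _ L) (f : K ⟶ L) : toDbGp A K hK ⟶ toDbGp A L hL :=
  (gAcyclicKb A).trW.Q.map (toKbMap hK hL f)

variable {K L M : CochainComplex (FGModuleCat.{u} A) ℤ} (hK : IsBounded _ K)
    (hL : IsBounded _ L) (hM : IsBounded _ M)

lemma toDbGpMap_comp (f : K ⟶ L) (g : L ⟶ M) :
    toDbGpMap hK hM (f ≫ g) = toDbGpMap hK hL f ≫ toDbGpMap hL hM g :=
  (congrArg _ (toKbMap_comp hK hL hM f g)).trans ((gAcyclicKb A).trW.Q.map_comp _ _)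

lemma toDbGpMap_id : toDbGpMap hK hK (𝟙 K) = 𝟙 _ :=
  (congrArg _ (toKbMap_id hK)).trans ((gAcyclicKb A).trW.Q.map_id _)

lemma toDbGpMap_add (f g : K ⟶ L) :
    toDbGpMap hK hL (f + g) = toDbGpMap hK hL f + toDbGpMap hK hL g :=
  (congrArg _ (toKbMap_add hK hL f g)).trans (gAcyclicKb A).trW.Q.map_add

lemma toDbGp_distinguished (φ : K ⟶ L) :
    ∃ h, Triangle.mk (toDbGpMap hK hL φ) (toDbGpMap hL (isBounded_mappingCone φ hK hL)
      (CochainComplex.mappingCone.inr φ)) h ∈ distTriang (DbGp A) := by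
  obtain ⟨h, hT⟩ := toKb_distinguished φ hK hL
  exact ⟨_, (gAcyclicKb A).trW.Q.map_distinguished _ hT⟩

lemma isZero_toDbGp (h : gAcyclicKb A ⟨(HomotopyCategory.quotient _ _).obj K, hK⟩) :
    IsZero (toDbGp A K hK) := by
  have h0 := ObjectProperty.trW.mk _ (contractible_distinguished₁ (toKb K hK)) h
  have := Localization.inverts (gAcyclicKb A).trW.Q _ _ h0
  exact ((gAcyclicKb A).trW.Q.map_isZero (isZero_zero _)).of_iso
    (@asIso _ _ _ _ _ this).symm

lemma toDbGpMap_surjective (h : ∀ i, gproj A (K.X i)) (f : toDbGp A K hK ⟶ toDbGp A L hL) :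
    ∃ φ : K ⟶ L, toDbGpMap hK hL φ = f := by
  obtain ⟨g, rfl⟩ := ((leftOrthogonal_of_gproj hK h).map_bijective_of_isTriangulated
    (gAcyclicKb A).trW.Q (toKb L hL)).2 f
  obtain ⟨φ, rfl⟩ := toKbMap_surjective hK hL g
  exact ⟨φ, rfl⟩

end

lemma distinguished_of_iso₂ {T : Type u} [Category.{v} T] [Preadditive T] [HasZeroObject T]
    [HasShift T ℤ] [∀ n : ℤ, (shiftFunctor T n).Additive] [Pretriangulated T] {X Y Z X' : T}
    {f : X ⟶ Y} {g : Y ⟶ Z} {h : Z ⟶ X⟦(1 : ℤ)⟧} (hT : Triangle.mk f g h ∈ distTriang T)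
    (e : Y ≅ X') : Triangle.mk (f ≫ e.hom) (e.inv ≫ g) h ∈ distTriang T :=
  isomorphic_distinguished _ hT _
    (Triangle.isoMk _ _ (Iso.refl _) e.symm (Iso.refl _)
      ((Category.assoc _ _ _).trans ((congrArg _ e.hom_inv_id).trans
        ((Category.comp_id _).trans (Category.id_comp _).symm)))
      (Category.comp_id _)
      ((congrArg _ (CategoryTheory.Functor.map_id _ _)).trans
        ((Category.comp_id _).trans (Category.id_comp _).symm)))

/-! ### Stalk complexes and cocycles -/

section

variable {C : Type u} [Category.{v} C] [Preadditive C] [HasZeroObject C]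

lemma single_hom_ext {G : C} {j : ℤ} {K : CochainComplex C ℤ}
    {f g : (CochainComplex.singleFunctor C j).obj G ⟶ K} (h : f.f j = g.f j) : f = g :=
  HomologicalComplex.from_single_hom_ext h

lemma singleFunctor_map_f {G H : C} (j : ℤ) (r : G ⟶ H) :
    ((CochainComplex.singleFunctor C j).map r).f j =
      (singleXSelf G j).hom ≫ r ≫ (singleXSelf H j).inv :=
  HomologicalComplex.single_map_f_self _ _ _

lemma homOfCocycle_add {G : C} {K : CochainComplex C ℤ} {j : ℤ} (g h : G ⟶ K.X j)
    (hg : g ≫ K.d j (j + 1) = 0) (hh : h ≫ K.d j (j + 1) = 0)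
    (hgh : (g + h) ≫ K.d j (j + 1) = 0) :
    homOfCocycle (g + h) hgh = homOfCocycle g hg + homOfCocycle h hh := by
  refine single_hom_ext ?_
  rw [HomologicalComplex.add_f_apply, homOfCocycle_f, homOfCocycle_f, homOfCocycle_f,
    Preadditive.comp_add]

lemma singleFunctor_map_comp_homOfCocycle {G H : C} {K : CochainComplex C ℤ} {j : ℤ}
    (r : H ⟶ G) (g : G ⟶ K.X j) (hg : g ≫ K.d j (j + 1) = 0)
    (hrg : (r ≫ g) ≫ K.d j (j + 1) = 0) :
    (CochainComplex.singleFunctor C j).map r ≫ homOfCocycle g hg = homOfCocycle (r ≫ g) hrg := by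
  refine single_hom_ext ?_
  rw [HomologicalComplex.comp_f, homOfCocycle_f, homOfCocycle_f, singleFunctor_map_f,
    Category.assoc, Category.assoc, Iso.inv_hom_id_assoc]

lemma exists_homOfCocycle {G : C} {K : CochainComplex C ℤ} {j : ℤ}
    (f : (CochainComplex.singleFunctor C j).obj G ⟶ K) :
    ∃ (g : G ⟶ K.X j) (hg : g ≫ K.d j (j + 1) = 0), homOfCocycle g hg = f := by
  refine ⟨(singleXSelf G j).inv ≫ f.f j, ?_, single_hom_ext ?_⟩
  · rw [Category.assoc, f.comm]
    refine (congrArg _ zero_comp).trans comp_zero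
  · rw [homOfCocycle_f, Iso.hom_inv_id_assoc]

/-- The cocycles of degree `0` of the complex `Hom(G, K)`. -/
def homCocycles (G : C) (K : CochainComplex C ℤ) : Submodule (End G)ᵐᵒᵖ (G ⟶ K.X 0) where
  carrier := {g | g ≫ K.d 0 (0 + 1) = 0}
  add_mem' {g h} hg hh := by
    exact (Preadditive.add_comp _ _ _ _ _ _).trans ((congrArg₂ _ hg hh).trans (add_zero _))
  zero_mem' := zero_comp
  smul_mem' c g hg := (Category.assoc c.unop g _).trans ((congrArg _ hg).trans comp_zero)

lemma IsBounded.truncLE {C : Type u} [Category.{v} C] [Abelian C] {K : CochainComplex C ℤ}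
    (hK : IsBounded C K) (n : ℤ) : IsBounded C (K.truncLE n) := by
  obtain ⟨a, b, _, _⟩ := hK
  exact ⟨a, n, inferInstance, inferInstance⟩

end

/-! ### Finite length of Hom out of a stalk complex -/

section

variable {A : Type u} [Ring A] {G : FGModuleCat.{u} A}

lemma isBounded_single (G : FGModuleCat.{u} A) (j : ℤ) :
    IsBounded _ ((CochainComplex.singleFunctor _ j).obj G) :=
  ⟨j, j, inferInstance, inferInstance⟩

lemma extLE_toDbGp (hG : gproj A G) {K : CochainComplex (FGModuleCat.{u} A) ℤ}
    (hK : IsBounded _ K) (b : ℤ) [K.IsStrictlyLE b] : ExtLE (stalk A G) b (toDbGp A K hK) :=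
  fun i hi => (extVanish_stalk_iff hG hK).2
    (homExactAt_of_isZero (K.isZero_of_isStrictlyLE b i hi))

lemma extGE_toDbGp (hG : gproj A G) {K : CochainComplex (FGModuleCat.{u} A) ℤ}
    (hK : IsBounded _ K) (a : ℤ) [K.IsStrictlyGE a] : ExtGE (stalk A G) a (toDbGp A K hK) :=
  fun i hi => (extVanish_stalk_iff hG hK).2
    (homExactAt_of_isZero (K.isZero_of_isStrictlyGE a i hi))

/-- The morphism between stalk complexes in `Dᵇ_gp(A-mod)` given by a linear map. -/
noncomputable def stalkMap {G H : FGModuleCat.{u} A} (r : G ⟶ H) : stalk A G ⟶ stalk A H :=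
  toDbGpMap (isBounded_single G 0) (isBounded_single H 0)
    ((CochainComplex.singleFunctor _ 0).map r)

lemma stalkMap_id (G : FGModuleCat.{u} A) : stalkMap (𝟙 G) = 𝟙 (stalk A G) := by
  rw [stalkMap, CategoryTheory.Functor.map_id]
  exact toDbGpMap_id _

lemma stalkMap_comp {G H K : FGModuleCat.{u} A} (r : G ⟶ H) (s : H ⟶ K) :
    stalkMap (r ≫ s) = stalkMap r ≫ stalkMap s := by
  rw [stalkMap, Functor.map_comp]
  exact toDbGpMap_comp _ _ _ _ _

lemma stalkMap_add {G H : FGModuleCat.{u} A} (r s : G ⟶ H) :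
    stalkMap (r + s) = stalkMap r + stalkMap s := by
  rw [stalkMap, Functor.map_add]
  exact toDbGpMap_add _ _ _ _

/-- The stalk functor on endomorphism rings. -/
noncomputable def stalkEnd (G : FGModuleCat.{u} A) : End G →+* End (stalk A G) :=
  RingHom.mk' { toFun := fun r => stalkMap r
                map_one' := stalkMap_id G
                map_mul' := fun r s => stalkMap_comp s r } fun r s => stalkMap_add r s

/-- The class of a cocycle in `Hom(G, K)`, as a semilinear map. -/
noncomputable def homCocyclesToDbGp (G : FGModuleCat.{u} A)
    {K : CochainComplex (FGModuleCat.{u} A) ℤ} (hK : IsBounded _ K) :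
    homCocycles G K →ₛₗ[(stalkEnd G).op] (stalk A G ⟶ toDbGp A K hK) where
  toFun g := toDbGpMap (isBounded_single G 0) hK (homOfCocycle g.1 g.2)
  map_add' g h := (congrArg _ (homOfCocycle_add g.1 h.1 g.2 h.2 (g + h).2)).trans
    (toDbGpMap_add _ _ _ _)
  map_smul' c g := (congrArg _ (singleFunctor_map_comp_homOfCocycle c.unop g.1 g.2
    (c • g).2).symm).trans (toDbGpMap_comp _ _ _ _ _)

lemma homCocyclesToDbGp_surjective (hG : gproj A G) {K : CochainComplex (FGModuleCat.{u} A) ℤ}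
    (hK : IsBounded _ K) : Function.Surjective (homCocyclesToDbGp G hK) := fun f => by
  obtain ⟨φ, rfl⟩ := toDbGpMap_surjective _ hK (gproj_single hG 0) f
  obtain ⟨g, hg, rfl⟩ := exists_homOfCocycle φ
  exact ⟨⟨g, hg⟩, rfl⟩

variable (k : Type w) [CommRing k] [IsArtinianRing k] [Algebra k A] [Module.Finite k A]

-- Every morphism is the class of a cocycle in Hom(G, K⁰), so the Hom group is a semilinear quotient
-- of a submodule of a module satisfying both chain conditions.
include k in
lemma isNoetherian_isArtinian_stalk_hom (hG : gproj A G) (X : DbGp A) :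
    IsNoetherian (End (stalk A G))ᵐᵒᵖ (stalk A G ⟶ X) ∧
      IsArtinian (End (stalk A G))ᵐᵒᵖ (stalk A G ⟶ X) := by
  obtain ⟨K, hK, ⟨e⟩⟩ := exists_iso_toDbGp X
  obtain ⟨_, _⟩ := isNoetherian_isArtinian_hom k G (K.X 0)
  let f : (stalk A G ⟶ toDbGp A K hK) →ₗ[(End (stalk A G))ᵐᵒᵖ] (stalk A G ⟶ X) :=
    { toFun := fun f => f ≫ e.hom
      map_add' := fun f g => Preadditive.add_comp _ _ _ _ _ _
      map_smul' := fun c f => Category.assoc c.unop f e.hom }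
  exact isNoetherian_isArtinian_of_surjective f
    (fun g => ⟨g ≫ e.inv, (Category.assoc _ _ _).trans
      ((congrArg _ e.inv_hom_id).trans (Category.comp_id g))⟩)
    (isNoetherian_isArtinian_of_surjective _ (homCocyclesToDbGp_surjective hG hK)
      ⟨inferInstance, inferInstance⟩)

end

/-! ### The t-structure on the Gorenstein derived category -/

section

variable {A : Type u} [Ring A] [IsNoetherianRing A] [IsArtinianRing A] {GA : FGModuleCat.{u} A}
  (hGA : IsGprojGenerator A GA) {K L : CochainComplex (FGModuleCat.{u} A) ℤ}
  (hK : IsBounded _ K) (hL : IsBounded _ L)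

include hGA

lemma isIso_toDbGpMap (φ : K ⟶ L) (h : ∀ i, HomExactAt GA (CochainComplex.mappingCone φ) i) :
    IsIso (toDbGpMap hK hL φ) := by
  obtain ⟨_, hT⟩ := toDbGp_distinguished hK hL φ
  exact (Triangle.isZero₃_iff_isIso₁ _ hT).1 (isZero_toDbGp _ (gAcyclicKb_of_generator hGA _ h))

lemma isIso_toDbGpMap_ιTruncLE {n : ℤ} (hn : ExtLE (stalk A GA) n (toDbGp A K hK)) :
    IsIso (toDbGpMap (hK.truncLE n) hK (K.ιTruncLE n)) := by
  refine isIso_toDbGpMap hGA _ _ _ fun i => ?_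
  by_cases hi : i ≤ n
  · exact homExactAt_mappingCone_ιTruncLE hi
  · obtain ⟨_, hT⟩ := toDbGp_distinguished (hK.truncLE n) hK (K.ιTruncLE n)
    have hG := gproj_of_isGprojGenerator hGA
    exact (extVanish_stalk_iff hG _).1
      (ExtVanish.ext₃ hT rfl (hn i (by lia)) (extLE_toDbGp hG (hK.truncLE n) n _ (by lia)))

lemma exists_iso_toDbGp_of_extLE {X : DbGp A} {n : ℤ} (hX : ExtLE (stalk A GA) n X) :
    ∃ (K : CochainComplex (FGModuleCat.{u} A) ℤ) (hK : IsBounded _ K), K.IsStrictlyLE n ∧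
      Nonempty (toDbGp A K hK ≅ X) := by
  obtain ⟨K, hK, ⟨e⟩⟩ := exists_iso_toDbGp X
  have := isIso_toDbGpMap_ιTruncLE hGA hK (hX.of_iso e.symm)
  exact ⟨K.truncLE n, hK.truncLE n, inferInstance,
    ⟨asIso (toDbGpMap (hK.truncLE n) hK (K.ιTruncLE n)) ≪≫ e⟩⟩

/-- By naturality of truncation the map factors through the truncation of `L` below degree 0, which
is G-acyclic and hence a zero object, while `K` is isomorphic to its own truncation. -/
lemma toDbGpMap_eq_zero (hX : ExtLE (stalk A GA) (-1) (toDbGp A K hK))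
    (hY : ExtGE (stalk A GA) 0 (toDbGp A L hL)) (φ : K ⟶ L) : toDbGpMap hK hL φ = 0 := by
  have := isIso_toDbGpMap_ιTruncLE hGA hK hX
  have hZ : IsZero (toDbGp A (L.truncLE (-1)) (hL.truncLE (-1))) :=
    isZero_toDbGp _ (gAcyclicKb_of_generator hGA _ (homExactAt_truncLE fun i hi =>
      (extVanish_stalk_iff (gproj_of_isGprojGenerator hGA) hL).1 (hY i (by lia))))
  rw [← cancel_epi (toDbGpMap (hK.truncLE (-1)) hK (K.ιTruncLE (-1))), comp_zero,
    ← toDbGpMap_comp, ← CochainComplex.ιTruncLE_naturality, toDbGpMap_comp _ (hL.truncLE (-1)),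
    hZ.eq_of_tgt (toDbGpMap _ _ (CochainComplex.truncLEMap φ (-1))) 0, zero_comp]

/-- A general morphism is a right fraction; its numerator is a chain map from an isomorphic object,
so the case of chain maps applies. -/
lemma hom_eq_zero_of_extLE_of_extGE {X Y : DbGp A} (hX : ExtLE (stalk A GA) (-1) X)
    (hY : ExtGE (stalk A GA) 0 Y) (f : X ⟶ Y) : f = 0 := by
  obtain ⟨K, hK, ⟨e⟩⟩ := exists_iso_toDbGp X
  obtain ⟨L, hL, ⟨e'⟩⟩ := exists_iso_toDbGp Y
  rw [← cancel_epi e.hom, ← cancel_mono e'.inv, comp_zero, zero_comp]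
  obtain ⟨φ, hφ⟩ := Localization.exists_rightFraction (gAcyclicKb A).trW.Q (gAcyclicKb A).trW
    (X := toKb K hK) (Y := toKb L hL) ((e.hom ≫ f) ≫ e'.inv)
  have := Localization.inverts (gAcyclicKb A).trW.Q (gAcyclicKb A).trW φ.s φ.hs
  obtain ⟨ψ, hψ⟩ := toKbMap_surjective φ.X'.property hL φ.f
  refine hφ.trans ?_
  refine (cancel_epi ((gAcyclicKb A).trW.Q.map φ.s)).1 ?_
  rw [MorphismProperty.RightFraction.map_s_comp_map, ← hψ]
  refine Eq.trans ?_ comp_zero.symm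
  exact toDbGpMap_eq_zero hGA _ hL
    (hX.of_iso (e.symm ≪≫ (asIso ((gAcyclicKb A).trW.Q.map φ.s)).symm))
    (fun i hi => (hY i hi).of_iso e'.symm) ψ

omit [IsArtinianRing A] in
lemma exists_distinguished_truncation (X : DbGp A) : ∃ (U V : DbGp A) (f : U ⟶ X) (g : X ⟶ V)
    (h : V ⟶ U⟦(1 : ℤ)⟧), Triangle.mk f g h ∈ distTriang (DbGp A) ∧
      ExtLE (stalk A GA) (-1) U ∧ ExtGE (stalk A GA) 0 V := by
  obtain ⟨K, hK, ⟨e⟩⟩ := exists_iso_toDbGp X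
  have hG := gproj_of_isGprojGenerator hGA
  obtain ⟨h, hT⟩ := toDbGp_distinguished (hK.truncLE (-1)) hK (K.ιTruncLE (-1))
  exact ⟨_, _, _, _, h, distinguished_of_iso₂ hT e, extLE_toDbGp hG _ (-1), fun i hi => (extVanish_stalk_iff hG _).2
      (homExactAt_mappingCone_ιTruncLE (by lia))⟩

variable (k : Type w) [CommRing k] [IsArtinianRing k] [Algebra k A] [Module.Finite k A]

include k in
lemma isHeartGenerator_stalk : IsHeartGenerator (stalk A GA) where
  self i hi := (extVanish_stalk_iff (gproj_of_isGprojGenerator hGA) _).2 (homExactAt_single hi)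
  exists_trunc := exists_distinguished_truncation hGA
  orth := hom_eq_zero_of_extLE_of_extGE hGA
  bounded X := by
    obtain ⟨K, hK, ⟨e⟩⟩ := exists_iso_toDbGp X
    obtain ⟨a, b, _, _⟩ := id hK
    have hG := gproj_of_isGprojGenerator hGA
    exact ⟨a, b, fun i hi => (extGE_toDbGp hG hK a i hi).of_iso e,
      (extLE_toDbGp hG hK b).of_iso e⟩
  isNoetherian X :=
    (isNoetherian_isArtinian_stalk_hom k (gproj_of_isGprojGenerator hGA) X).1
  isArtinian X :=
    (isNoetherian_isArtinian_stalk_hom k (gproj_of_isGprojGenerator hGA) X).2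

end

/-! ### Approximation by powers of the generator -/

section

variable {T : Type u} [Category.{v} T] [Preadditive T] [HasZeroObject T] [HasShift T ℤ]
  [∀ n : ℤ, (shiftFunctor T n).Additive] [Pretriangulated T] {G : T} (hG : IsHeartGenerator G)

include hG

/-- An object of the aisle which is left orthogonal to a shift of the aisle is the cone of a
morphism to a power of the generator from an object of the aisle which satisfies a stronger
orthogonality condition. -/
lemma IsHeartGenerator.exists_presentation {X : T} (hX : ExtLE G 0 X) {n : ℤ} (hn : n ≤ -1)
    (h : ∀ W, ExtLE G (n - 1) W → ∀ f : X ⟶ W, f = 0) :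
    ∃ (r : ℕ) (U : T) (u : U ⟶ power G r) (f : power G r ⟶ X) (g : X ⟶ U⟦(1 : ℤ)⟧),
      Triangle.mk u f g ∈ distTriang T ∧ ExtLE G 0 U ∧
        ∀ W, ExtLE G n W → ∀ f : U ⟶ W, f = 0 := by
  obtain ⟨r, V, f, g, k, hT, hV⟩ := hG.exists_cover hX
  refine ⟨r, _, _, _, _, inv_rot_of_distTriang _ hT, (extLE_shift_iff (by simp)).2 hV,
    fun W hW (α : V⟦(-1 : ℤ)⟧ ⟶ W) => ?_⟩
  let e : V⟦(-1 : ℤ)⟧⟦(1 : ℤ)⟧ ≅ V := shiftNegShift V 1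
  have hW' : ExtLE G (n - 1) (W⟦(1 : ℤ)⟧) := (extLE_shift_iff (by lia)).2 hW
  -- By orthogonality of `X`, the map from `V` to `W⟦1⟧` factors through the shifted power of `G`.
  -- The remaining map is the shift of one from that power to `W`, which vanishes since `W` lies in
  -- degrees at most n ≤ -1.
  have hα : e.inv ≫ α⟦(1 : ℤ)⟧' = 0 := by
    obtain ⟨β, hβ⟩ := Triangle.yoneda_exact₃ _ hT (e.inv ≫ α⟦(1 : ℤ)⟧') (h _ hW' _)
    obtain ⟨β, rfl⟩ := (shiftFunctor T (1 : ℤ)).map_surjective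
      (X := power G r) (Y := W) β
    have : β = 0 := biproduct.hom_ext' _ _ fun j =>
      (extVanish_zero_iff.1 (hW 0 (by lia)) _).trans comp_zero.symm
    rw [this, Functor.map_zero] at hβ
    exact hβ.trans comp_zero
  exact (shiftFunctor T (1 : ℤ)).map_injective (((cancel_epi e.inv).1
    (hα.trans comp_zero.symm)).trans (Functor.map_zero _ _ _).symm)

/-- An object of the aisle which is left orthogonal to the shifted aisle is a direct summand of a
power of the generator. -/
lemma IsHeartGenerator.exists_retract_power {X : T} (hX : ExtLE G 0 X)
    (h : ∀ W, ExtLE G (-1) W → ∀ f : X ⟶ W, f = 0) :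
    ∃ (r : ℕ) (s : X ⟶ power G r) (p : power G r ⟶ X), s ≫ p = 𝟙 X := by
  obtain ⟨r, V, f, g, k, hT, hV⟩ := hG.exists_cover hX
  obtain ⟨s, hs⟩ := Triangle.coyoneda_exact₂ _ hT (𝟙 X)
    ((Category.id_comp _).trans (h V hV g))
  exact ⟨r, s, f, hs.symm⟩

end

/-! ### The stalk functor, summands and shifts -/

section

variable {A : Type u} [Ring A]

variable (A) in
/-- The functor sending a module to its stalk complex in degree `0`. -/
noncomputable def stalkFunctor : FGModuleCat.{u} A ⥤ DbGp A where
  obj := stalk A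
  map := stalkMap
  map_id := stalkMap_id
  map_comp := stalkMap_comp

instance : (stalkFunctor A).Additive where
  map_add := stalkMap_add _ _

lemma stalkMap_injective {G H : FGModuleCat.{u} A} (hG : gproj A G) {r s : G ⟶ H}
    (h : stalkMap r = stalkMap s) : r = s := by
  have h1 := ((leftOrthogonal_of_gproj (isBounded_single G 0)
    (gproj_single hG 0)).map_bijective_of_isTriangulated
      (gAcyclicKb A).trW.Q (toKb _ (isBounded_single H 0))).1 h
  have h2 : Homotopy ((CochainComplex.singleFunctor _ 0).map r)
      ((CochainComplex.singleFunctor _ 0).map s) := HomotopyCategory.homotopyOfEq _ _ (congrArg (bounded _).ι.map h1)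
  have h3 := h2.comm 0
  rw [dNext_eq _ (show (ComplexShape.up ℤ).Rel 0 1 by simp),
    prevD_eq _ (show (ComplexShape.up ℤ).Rel (-1) 0 by simp)] at h3
  have h4 : ((CochainComplex.singleFunctor _ 0).obj G).d 0 1 = 0 := rfl
  have h5 : ((CochainComplex.singleFunctor _ 0).obj H).d (-1) 0 = 0 := rfl
  rw [h4, h5, zero_comp, comp_zero, zero_add, zero_add, singleFunctor_map_f,
    singleFunctor_map_f] at h3
  simpa using h3

/-- The idempotent on the stalk complex comes from an idempotent endomorphism of `M`, the stalk
functor being fully faithful on Gorenstein projectives, and that one splits among finitely generated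
modules. -/
lemma exists_iso_stalk_of_retract {X : DbGp A} {M : FGModuleCat.{u} A} [IsNoetherianRing A]
    (hM : gproj A M) (s : X ⟶ stalk A M) (p : stalk A M ⟶ X) (hsp : s ≫ p = 𝟙 X) :
    ∃ N, gproj A N ∧ Nonempty (X ≅ stalk A N) := by
  obtain ⟨φ, hφ⟩ := toDbGpMap_surjective _ (isBounded_single M 0) (gproj_single hM 0) (p ≫ s)
  obtain ⟨e, rfl⟩ := (CochainComplex.singleFunctor _ 0).map_surjective φ
  have he : stalkMap e = p ≫ s := hφ
  have hee : e ≫ e = e := stalkMap_injective hM (by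
    rw [stalkMap_comp, he, Category.assoc, reassoc_of% hsp])
  obtain ⟨N, i, q, hiq, hqi⟩ := IsIdempotentComplete.idempotents_split M e hee
  refine ⟨N, (gproj_isSummandClosed A).of_retract i q hiq hM,
    ⟨⟨s ≫ stalkMap q, stalkMap i ≫ p, ?_, ?_⟩⟩⟩
  · rw [Category.assoc, ← Category.assoc (stalkMap q), ← stalkMap_comp, hqi, he, Category.assoc,
      hsp, Category.comp_id, hsp]
  · rw [Category.assoc, ← Category.assoc p, ← he, ← stalkMap_comp, ← stalkMap_comp, ← hqi,
      Category.assoc, hiq, Category.comp_id, hiq, stalkMap_id]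

lemma gproj_mappingCone {K L : CochainComplex (FGModuleCat.{u} A) ℤ} (φ : K ⟶ L)
    (hK : ∀ i, gproj A (K.X i)) (hL : ∀ i, gproj A (L.X i)) (i : ℤ) :
    gproj A ((CochainComplex.mappingCone φ).X i) := by
  refine (gproj_isSummandClosed A).of_retract
    (biprod.lift ((CochainComplex.mappingCone.fst φ).1.v i (i + 1) rfl)
      ((CochainComplex.mappingCone.snd φ).v i i (add_zero i)))
    (biprod.desc ((CochainComplex.mappingCone.inl φ).v (i + 1) i (by lia))
      ((CochainComplex.mappingCone.inr φ).f i)) ?_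
    ((gproj_isSummandClosed A).biprod _ _ (hK (i + 1)) (hL i))
  rw [biprod.lift_desc, CochainComplex.mappingCone.id_X]

lemma IsoToGprojComplexIn.of_iso {X Y : DbGp A} {a b : ℤ} (h : IsoToGprojComplexIn A a b X)
    (e : X ≅ Y) : IsoToGprojComplexIn A a b Y := by
  obtain ⟨T, ha, hb, hT, ⟨e'⟩⟩ := h
  exact ⟨T, ha, hb, hT, ⟨e.symm ≪≫ e'⟩⟩

/-- The passage from complexes to `Dᵇ_gp(A-mod)` commutes with the shift. -/
lemma nonempty_shift_toDbGp_iso {K : CochainComplex (FGModuleCat.{u} A) ℤ} (hK : IsBounded _ K)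
    (n : ℤ) (hKn : IsBounded _ (K⟦n⟧)) : Nonempty ((toDbGp A K hK)⟦n⟧ ≅ toDbGp A (K⟦n⟧) hKn) := by
  let e : (toKb K hK)⟦n⟧ ≅ toKb (K⟦n⟧) hKn := (bounded _).ι.preimageIso
    (((bounded _).ι.commShiftIso n).app (toKb K hK) ≪≫
      (((HomotopyCategory.quotient _ (ComplexShape.up ℤ)).commShiftIso n).app K).symm)
  exact ⟨(((gAcyclicKb A).trW.Q.commShiftIso n).app (toKb K hK)).symm ≪≫
    (gAcyclicKb A).trW.Q.mapIso e⟩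

lemma IsoToGprojComplexIn.shift {X : DbGp A} {a b : ℤ} (h : IsoToGprojComplexIn A a b X)
    {n a' b' : ℤ} (ha' : n + a' = a) (hb' : n + b' = b) :
    IsoToGprojComplexIn A a' b' (X⟦n⟧) := by
  obtain ⟨T, ha, hb, hT, ⟨e⟩⟩ := h
  have ha := T.isStrictlyGE_shift a n a' (by lia)
  have hb := T.isStrictlyLE_shift b n b' (by lia)
  obtain ⟨e'⟩ := nonempty_shift_toDbGp_iso ⟨a, b, ‹_›, ‹_›⟩ n ⟨a', b', ha, hb⟩
  exact ⟨T⟦n⟧, ha, hb, fun i => hT _, ⟨(shiftFunctor _ n).mapIso e ≪≫ e'⟩⟩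

end

/-! ### Intrinsic description of complexes of Gorenstein projectives -/

section

variable {A : Type u} [Ring A] {GA : FGModuleCat.{u} A}
  (k : Type w) [CommRing k] [IsArtinianRing k] [Algebra k A] [Module.Finite k A]
  [IsNoetherianRing A] [IsArtinianRing A]
  (hGA : IsGprojGenerator A GA)

/-- A power of a stalk complex is a stalk complex. -/
noncomputable def powerStalkIso (GA : FGModuleCat.{u} A) (r : ℕ) :
    power (stalk A GA) r ≅ stalk A (⨁ fun _ : Fin r => GA) :=
  ((stalkFunctor A).mapBiproduct fun _ : Fin r => GA).symm

include hGA

-- Induction on the width: the syzygy `U` of a cover satisfies the same conditions with width one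
-- less, its map to the power of `G` lifts to a chain map, and the cone of that map represents `X`.
include k in
lemma isoToGprojComplexIn_of_extLE (m : ℕ) {X : DbGp A} (hX : ExtLE (stalk A GA) 0 X)
    (h : ∀ W, ExtLE (stalk A GA) (-m - 1) W → ∀ f : X ⟶ W, f = 0) :
    IsoToGprojComplexIn A (-m) 0 X := by
  have hG := isHeartGenerator_stalk hGA k
  have hgp (r : ℕ) : gproj A (⨁ fun _ : Fin r => GA) :=
    (gproj_isSummandClosed A).biproduct _ fun _ => gproj_of_isGprojGenerator hGA
  induction m generalizing X with
  | zero =>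
    obtain ⟨r, s, p, hsp⟩ := hG.exists_retract_power hX (by simpa using h)
    obtain ⟨N, hN, ⟨e⟩⟩ := exists_iso_stalk_of_retract (hgp r) (s ≫ (powerStalkIso GA r).hom)
      ((powerStalkIso GA r).inv ≫ p) (by simp [hsp])
    refine ⟨_, ?_, ?_, gproj_single hN 0, ⟨e⟩⟩
    · exact inferInstanceAs (((CochainComplex.singleFunctor _ 0).obj N).IsStrictlyGE 0)
    · infer_instance
  | succ m ih =>
    obtain ⟨r, U, u, f, g, hT, hU, hU'⟩ := hG.exists_presentation hX (n := -m - 1) (by lia)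
      fun W hW => h W (by convert hW using 1; push_cast; ring)
    obtain ⟨K, ha, hb, hK, ⟨e⟩⟩ := ih hU hU'
    have hKb : IsBounded _ K := ⟨_, _, ha, hb⟩
    obtain ⟨φ, hφ⟩ := toDbGpMap_surjective hKb (isBounded_single (⨁ fun _ : Fin r => GA) 0) hK
      (e.inv ≫ u ≫ (powerStalkIso GA r).hom)
    obtain ⟨k, hT'⟩ := toDbGp_distinguished hKb (isBounded_single (⨁ fun _ : Fin r => GA) 0) φ
    let E := isoTriangleOfIso₁₂ _ _ hT hT' e (powerStalkIso GA r) (by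
      refine ((Iso.eq_inv_comp e).1 hφ).symm)
    refine ⟨_, ?_, ?_, gproj_mappingCone φ hK (gproj_single (hgp r) 0), ⟨Triangle.π₃.mapIso E⟩⟩
    · exact CochainComplex.isStrictlyGE_mappingCone φ (-m) 0 _ (by push_cast; lia) (by lia)
    · rw [CochainComplex.isStrictlyLE_iff]
      exact fun i hi => isZero_mappingCone_X φ rfl (K.isZero_of_isStrictlyLE 0 _ (by lia))
        (CochainComplex.isZero_of_isStrictlyLE _ 0 _ hi)

/-- Truncation represents `W` by a complex in degrees at most a - 1, and `f` lifts to a chain map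
from a complex in degrees at least a, so no component survives. -/
lemma hom_eq_zero_of_isoToGprojComplexIn {X W : DbGp A} {a b : ℤ}
    (hX : IsoToGprojComplexIn A a b X) (hW : ExtLE (stalk A GA) (a - 1) W) (f : X ⟶ W) :
    f = 0 := by
  obtain ⟨K, ha, hb, hK, ⟨e⟩⟩ := hX
  obtain ⟨L, hL, hL', ⟨e'⟩⟩ := exists_iso_toDbGp_of_extLE hGA hW
  have hKb : IsBounded _ K := ⟨_, _, ha, hb⟩
  obtain ⟨φ, hφ⟩ := toDbGpMap_surjective hKb hL hK (e.inv ≫ f ≫ e'.inv)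
  -- Equality with its own double passes to the derived category by additivity and forces the image
  -- to be zero.
  have : φ = φ + φ := by
    refine HomologicalComplex.hom_ext _ _ fun i => ?_
    by_cases hi : a ≤ i
    · exact (L.isZero_of_isStrictlyLE (a - 1) i (by lia)).eq_of_tgt _ _
    · exact (K.isZero_of_isStrictlyGE a i (by lia)).eq_of_src _ _
  have h0 : toDbGpMap hKb hL φ = 0 := by
    have := (congrArg (toDbGpMap hKb hL) this).trans (toDbGpMap_add _ _ _ _)
    rwa [left_eq_add] at this
  rw [hφ] at h0
  rw [← cancel_epi e.inv, ← cancel_mono e'.inv, Category.assoc, h0, comp_zero, zero_comp]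

end

/-! ### The image of the generator under an equivalence -/

section

variable {A : Type u} [Ring A] {GA : FGModuleCat.{u} A} (hGA : IsGprojGenerator A GA)
  (kA : Type w) [CommRing kA] [IsArtinianRing kA] [Algebra kA A] [Module.Finite kA A]
  {B : Type v} [Ring B] {GB : FGModuleCat.{v} B} (hGB : IsGprojGenerator B GB)
  (kB : Type w') [CommRing kB] [IsArtinianRing kB] [Algebra kB B] [Module.Finite kB B]

include kA kB hGA hGB

/-- If an equivalence sends the generator to a Gorenstein projective complex concentrated in
degrees `[a, b]`, then its inverse sends the generator to such a complex in degrees `[-b, -a]`. -/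
theorem isoToGprojComplexIn_inverse_obj (F : DbGp A ≌ DbGp B) [F.functor.CommShift ℤ]
    [F.functor.IsTriangulated] {a b : ℤ} (hab : a ≤ b)
    (h : IsoToGprojComplexIn B a b (F.functor.obj (stalk A GA))) :
    IsoToGprojComplexIn A (-b) (-a) (F.inverse.obj (stalk B GB)) := by
  have : IsArtinianRing A := IsArtinianRing.of_finite kA A
  have : IsArtinianRing B := IsArtinianRing.of_finite kB B
  have : IsNoetherianRing A := isNoetherian_of_tower kA inferInstance
  have : IsNoetherianRing B := isNoetherian_of_tower kB inferInstance
  have hA := isHeartGenerator_stalk hGA kA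
  have hB := isHeartGenerator_stalk hGB kB
  have h1 : ExtLE (stalk A GA) (-a) (F.inverse.obj (stalk B GB)) :=
    IsHeartGenerator.extLE_inverse_obj F hB
      fun W hW => hom_eq_zero_of_isoToGprojComplexIn hGB h hW
  have h2 : ExtLE (stalk B GB) b (F.functor.obj (stalk A GA)) := by
    obtain ⟨K, ha, hb, hK, ⟨e⟩⟩ := h
    exact (extLE_toDbGp (gproj_of_isGprojGenerator hGB) _ b).of_iso e.symm
  obtain ⟨m, hm⟩ := Int.eq_ofNat_of_zero_le (sub_nonneg.2 hab)
  let Y := F.inverse.obj (stalk B GB)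
  -- Shifting by -a moves the expected range [-b, -a] to [-m, 0] with m = b - a, the normalization
  -- used in the intrinsic description.
  have h3 : IsoToGprojComplexIn A (-m) 0 (Y⟦-a⟧) := by
    refine isoToGprojComplexIn_of_extLE kA hGA m ((extLE_shift_iff (by simp)).2 h1)
      fun W hW f => ?_
    have hW' : ExtLE (stalk A GA) (-b - 1) (W⟦a⟧) := (extLE_shift_iff (by lia)).2 hW
    have := hA.hom_inverse_obj_eq_zero F hB h2 hW' ((shiftNegShift Y a).inv ≫ f⟦a⟧')
    refine (shiftFunctor _ a).map_injective ?_
    rw [Functor.map_zero]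
    exact (cancel_epi (shiftNegShift Y a).inv).1 (this.trans comp_zero.symm)
  exact (h3.shift (n := a) (by lia) (by lia)).of_iso (shiftNegShift Y a)

end

end GorensteinDerived

theorem lemma2p1
    {kA : Type w} [CommRing kA] [IsArtinianRing kA]
    {kB : Type w'} [CommRing kB] [IsArtinianRing kB]
    (A : Type u) [Ring A] [Algebra kA A] [Module.Finite kA A]
    (B : Type v) [Ring B] [Algebra kB B] [Module.Finite kB B]
    (hA : GorensteinDerived.IsCMFinite A) (hB : GorensteinDerived.IsCMFinite B)
    (GA : FGModuleCat.{u} A) (hGA : GorensteinDerived.IsGprojGenerator A GA)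
    (GB : FGModuleCat.{v} B) (hGB : GorensteinDerived.IsGprojGenerator B GB)
    (F : GorensteinDerived.DbGp A ≌ GorensteinDerived.DbGp B)
    [F.functor.CommShift ℤ] [F.functor.IsTriangulated] (n : ℕ) :
    GorensteinDerived.IsoToGprojComplexIn B 0 n
        (F.functor.obj (GorensteinDerived.stalk A GA)) ↔
      GorensteinDerived.IsoToGprojComplexIn A (-n) 0
        (F.inverse.obj (GorensteinDerived.stalk B GB)) := by
  constructor
  · intro h
    simpa using GorensteinDerived.isoToGprojComplexIn_inverse_obj hGA kA hGB kB F (by lia) h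
  · intro h
    -- The inverse inherits its compatibility with shifts from `F` and is triangulated as an adjoint
    -- of a triangulated functor; the general statement then applies to `F.symm` with a = -n, b = 0.
    let _ : F.inverse.CommShift ℤ := F.commShiftInverse ℤ
    have : F.CommShift ℤ := F.commShift_of_functor ℤ
    have : F.inverse.IsTriangulated := F.toAdjunction.isTriangulated_rightAdjoint
    let _ : F.symm.functor.CommShift ℤ := F.commShiftInverse ℤ
    have : F.symm.functor.IsTriangulated := inferInstanceAs F.inverse.IsTriangulated
    simpa using GorensteinDerived.isoToGprojComplexIn_inverse_obj hGB kB hGA kA F.symm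
      (by lia) h
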